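/- Identify $\mathbb{R}^{2n}$ with $\mathbb{C}^n$ and let $J_{st}$ denote multiplication by $i$. Let $J$ be a smooth almost complex structure on $\mathbb{R}^{2n}$, that is, a smooth map $z\mapsto J(z)$ into the $\mathbb{R}$-linear operators of $\mathbb{R}^{2n}$ with $J(z)^2=-I$, and assume that $\det(J(z)+J_{st})\neq 0$ for every $z\in\mathbb{R}^{2n}$. Let $0<\alpha<1$ and $\epsilon>0$, let $\Gamma=\gamma([0,1])\subset\mathbb{C}$ be a smoothly embedded (compact) arc, where $\gamma\colon[0,1]\to\mathbb{C}$ is smooth and injective with $\gamma'\neq 0$ everywhere, and let $\varphi\colon\Gamma\to\mathbb{R}^{2n}$ be a $\mathcal{C}^2$-map, that is, $\varphi\circ\gamma$ is of class $\mathcal{C}^2$ on $[0,1]$. Then there exist an open neighborhood $U\subset\mathbb{C}$ of $\Gamma$ and a $J$-holomorphic map $u\colon U\to\mathbb{R}^{2n}$, that is, a $\mathcal{C}^1$-map with $J(u(\zeta))\circ d_\zeta u=d_\zeta u\circ J_{st}$ for all $\zeta\in U$ (equivalently $u_y=J(u)u_x$, where $\zeta=x+iy$), such that $$\|u-\varphi\|_{\mathcal{C}^{1,\alpha}(\Gamma)}<\epsilon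 .$$ Here, for a $\mathcal{C}^1$-map $f$ on $\Gamma$ with derivative $f'$ with respect to arc length, $$\|f\|_{\mathcal{C}^{1,\alpha}(\Gamma)}=\sup_{\Gamma}|f|+\sup_{\Gamma}|f'|+\sup_{\zeta\neq\zeta'\in\Gamma}\frac{|f'(\zeta)-f'(\zeta')|}{|\zeta-\zeta'|^{\alpha}} .$$ -/

import Mathlib

open Set
open scoped ContDiff ENNReal

/-- `ℝ²ⁿ`, identified with `ℂⁿ` with its Euclidean norm and regarded as a real normed space. -/
abbrev RealCn (n : ℕ) : Type := EuclideanSpace ℂ (Fin n)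

/-- The standard complex structure of `ℂⁿ`: multiplication by `i`, as a real linear operator. -/
noncomputable def Jst (n : ℕ) : RealCn n →L[ℝ] RealCn n :=
  (Complex.I • ContinuousLinearMap.id ℂ (RealCn n)).restrictScalars ℝ

/-- `J` is a smooth almost complex structure on `ℝ²ⁿ` with `det (J + J_st) ≠ 0` everywhere. -/
structure IsAdmissibleStructure {n : ℕ} (J : RealCn n → RealCn n →L[ℝ] RealCn n) : Prop where
  smooth : ContDiff ℝ ∞ J
  sq_eq_neg_id : ∀ z, (J z).comp (J z) = -ContinuousLinearMap.id ℝ (RealCn n)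
  det_ne_zero : ∀ z, LinearMap.det ((J z + Jst n : RealCn n →L[ℝ] RealCn n) :
    RealCn n →ₗ[ℝ] RealCn n) ≠ 0

/-- `u` is a `J`-holomorphic map on the open set `U ⊆ ℂ`: it is continuously differentiable and its
differential intertwines multiplication by `i` on `ℂ` with `J` along `u`. -/
def IsJHolomorphicOn {n : ℕ} (J : RealCn n → RealCn n →L[ℝ] RealCn n) (u : ℂ → RealCn n)
    (U : Set ℂ) : Prop :=
  ContDiffOn ℝ 1 u U ∧
    ∀ ζ ∈ U, ∀ v : ℂ, J (u ζ) (fderiv ℝ u ζ v) = fderiv ℝ u ζ (Complex.I * v)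

/-- `γ` restricted to `[0, 1]` is a smooth embedding into `ℂ`. -/
structure IsSmoothArc (γ : ℝ → ℂ) : Prop where
  smooth : ContDiffOn ℝ ∞ γ (Icc 0 1)
  injOn : InjOn γ (Icc 0 1)
  deriv_ne_zero : ∀ t ∈ Icc (0 : ℝ) 1, derivWithin γ (Icc 0 1) t ≠ 0

/-- The arc `Γ = γ([0, 1])`. -/
def arc (γ : ℝ → ℂ) : Set ℂ := γ '' Icc 0 1

/-- `f` is a map of class `C^k` on the arc `Γ = γ([0, 1])`; only the values of `f` on `Γ` matter. -/
def IsCkOnArc {n : ℕ} (k : ℕ) (γ : ℝ → ℂ) (f : ℂ → RealCn n) : Prop :=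
  ContDiffOn ℝ k (f ∘ γ) (Icc 0 1)

/-- The derivative of `f` along the arc `Γ` with respect to arc length, at the point `γ t`. -/
noncomputable def arcDeriv {n : ℕ} (γ : ℝ → ℂ) (f : ℂ → RealCn n) (t : ℝ) : RealCn n :=
  ‖derivWithin γ (Icc 0 1) t‖⁻¹ • derivWithin (f ∘ γ) (Icc 0 1) t

open Classical in
/-- The `C^{1,α}(Γ)`-norm of `f`, with value in `[0, ∞]`: the sum of the supremum of `|f|`, the
supremum of the derivative of `f` along `Γ`, and the `α`-Hölder seminorm of that derivative. It is
`∞` if `f` is not of class `C¹` on `Γ`. -/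
noncomputable def c1HolderNorm {n : ℕ} (α : ℝ) (γ : ℝ → ℂ) (f : ℂ → RealCn n) : ℝ≥0∞ :=
  if IsCkOnArc 1 γ f then
    (⨆ t ∈ Icc (0 : ℝ) 1, ENNReal.ofReal ‖f (γ t)‖)
      + (⨆ t ∈ Icc (0 : ℝ) 1, ENNReal.ofReal ‖arcDeriv γ f t‖)
      + ⨆ s ∈ Icc (0 : ℝ) 1, ⨆ t ∈ Icc (0 : ℝ) 1, ⨆ _ : s ≠ t,
          ENNReal.ofReal (‖arcDeriv γ f s - arcDeriv γ f t‖ / ‖γ s - γ t‖ ^ α)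
  else ∞

/-!
The idea is to extend a smooth approximation of `φ` to an approximate solution near the arc, and to
correct it on a tube so thin that the correction is small in `C^{1,α}`.

*Conjugation.* Since `J² = J_st² = -1`, the operator `P = J + J_st` satisfies `J P = P J_st`. It is
invertible by assumption, so with `Q = P⁻¹` a map `u` is `J`-holomorphic exactly when the real
differential `Q(u) ∘ du` has no antilinear part (`dbar_comp_eq_zero_iff`).

*Approximate solution.* Near the arc there is a coordinate `Θ = t + i s`, equal to the parameter
`t` on the arc and complex differentiable there (`exists_straightening`). A `C⁴` curve `p` that is
`C²`-close to `φ ∘ γ` (`exists_contDiff_four_near`) gives `u₀ = p(t) + s J(p(t)) p'(t)`, which is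
`C³` and solves the equation at the points of the arc (`exists_approximate_solution`). Choosing `p`
near `φ ∘ γ` in `C²`, instead of `φ ∘ γ` itself, makes the deviation from `φ` small in `C^{1,α}`
while `u₀` has the derivatives that the correction requires.

*Correction.* With `u = u₀ + P(u₀) w` the equation becomes `w_x + i w_y = A(ζ, w) dw + R(ζ, w)`,
with `A(ζ, 0) = 0` everywhere and `R(ζ, 0) = 0` on the arc (`exists_corrected_solution`). It is
solved in `exists_small_solution` by writing `w` as the Cauchy transform of a function `g`
supported in the `2δ`-neighbourhood of the arc and applying Banach's fixed point theorem to `g`.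
Hölder norms are taken at the length scale `δ` (`HolderBound`). In these norms the right-hand side
at `w = 0` is of size `O(δ)`. Moreover the Cauchy transform maps a ball of radius `N` to functions
of size `o(1) N`, with differentials of size `o(1) N / δ`, as `δ → 0`, because the arc has measure
zero and hence the potential `∫ |z - ζ|⁻¹` of its thin neighbourhoods tends to zero
(`exists_cauchyTransform_bound`, `eventually_potential_le`). So the fixed point map is a
contraction on a ball of radius `O(δ)`. For `g` in this ball `dw` is `o(1)`, and its unscaled
`α`-Hölder seminorm is `O(δ ^ (1 - α))`: here `α < 1` is used. Finally the `C^{1,α}` norm on the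
arc is bounded by that of extensions to the plane (`exists_c1HolderNorm_le`).
-/

/-! ### Scaled Hölder bounds -/

/-- `f` is bounded by `N` on `S` and `α`-Hölder there with constant `N * δ ^ (-α)`. The length scale
`δ` makes the bound invariant under a simultaneous dilation of the plane and of `δ`. -/
def HolderBound {X : Type*} [NormedAddCommGroup X] (α δ : ℝ) (S : Set ℂ) (N : ℝ) (f : ℂ → X) :
    Prop :=
  (∀ x ∈ S, ‖f x‖ ≤ N) ∧ ∀ x ∈ S, ∀ y ∈ S, ‖f x - f y‖ ≤ N * (‖x - y‖ / δ) ^ α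

namespace HolderBound

variable {X Y Z : Type*} [NormedAddCommGroup X] [NormedAddCommGroup Y] [NormedAddCommGroup Z]
  {α δ N M : ℝ} {S : Set ℂ} {f g : ℂ → X}

theorem mono (hδ : 0 < δ) (h : HolderBound α δ S N f) (hNM : N ≤ M) : HolderBound α δ S M f :=
  ⟨fun x hx => (h.1 x hx).trans hNM, fun x hx y hy => (h.2 x hx y hy).trans (by gcongr)⟩

theorem mono_set {T : Set ℂ} (h : HolderBound α δ S N f) (hT : T ⊆ S) : HolderBound α δ T N f :=
  ⟨fun x hx => h.1 x (hT hx), fun x hx y hy => h.2 x (hT hx) y (hT hy)⟩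

theorem zero (hδ : 0 < δ) (hN : 0 ≤ N) : HolderBound α δ S N (fun _ => (0 : X)) :=
  ⟨fun _ _ => by simpa using hN, fun x _ y _ => by simp; positivity⟩

theorem add (hf : HolderBound α δ S N f) (hg : HolderBound α δ S M g) :
    HolderBound α δ S (N + M) (fun x => f x + g x) := by
  refine ⟨fun x hx => (norm_add_le _ _).trans (add_le_add (hf.1 x hx) (hg.1 x hx)),
    fun x hx y hy => ?_⟩
  rw [add_sub_add_comm, add_mul]
  exact (norm_add_le _ _).trans (add_le_add (hf.2 x hx y hy) (hg.2 x hx y hy))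

theorem congr (hf : HolderBound α δ S N f) (h : ∀ x ∈ S, g x = f x) : HolderBound α δ S N g := by
  refine ⟨fun x hx => by rw [h x hx]; exact hf.1 x hx, fun x hx y hy => ?_⟩
  rw [h x hx, h y hy]; exact hf.2 x hx y hy

theorem continuous (hα : 0 < α) (hf : HolderBound α δ univ N f) : Continuous f := by
  rw [continuous_iff_continuousAt]
  intro x
  rw [ContinuousAt, tendsto_iff_norm_sub_tendsto_zero]
  have h1 : Filter.Tendsto (fun y : ℂ => N * (‖y - x‖ / δ) ^ α) (nhds x)
      (nhds (N * (‖x - x‖ / δ) ^ α)) := by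
    have : Continuous (fun y : ℂ => N * (‖y - x‖ / δ) ^ α) := by
      refine continuous_const.mul (Continuous.rpow_const (by fun_prop) fun y => Or.inr hα.le)
    exact this.tendsto x
  rw [sub_self, norm_zero, zero_div, Real.zero_rpow hα.ne', mul_zero] at h1
  exact squeeze_zero (fun _ => norm_nonneg _) (fun y => hf.2 y trivial x trivial) h1

/-- A Hölder estimate at distances at most `δ` suffices, since the sup bound takes care of the
larger ones. -/
theorem of_local (hα : 0 ≤ α) (hδ : 0 < δ) (hN : 0 ≤ N) (h0 : ∀ x ∈ S, ‖f x‖ ≤ N)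
    (h1 : ∀ x ∈ S, ∀ y ∈ S, ‖x - y‖ ≤ δ → ‖f x - f y‖ ≤ 2 * N * (‖x - y‖ / δ) ^ α) :
    HolderBound α δ S (2 * N) f := by
  refine ⟨fun x hx => (h0 x hx).trans (by linarith), fun x hx y hy => ?_⟩
  rcases le_total ‖x - y‖ δ with h | h
  · exact h1 x hx y hy h
  · have h2 : 1 ≤ (‖x - y‖ / δ) ^ α := Real.one_le_rpow ((one_le_div hδ).2 h) hα
    calc ‖f x - f y‖ ≤ ‖f x‖ + ‖f y‖ := norm_sub_le _ _
      _ ≤ 2 * N * 1 := by linarith [h0 x hx, h0 y hy]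
      _ ≤ _ := by gcongr

theorem self_le_rpow (hα : α ≤ 1) {t : ℝ} (ht : 0 ≤ t) (ht1 : t ≤ 1) : t ≤ t ^ α := by
  rcases ht.eq_or_lt with rfl | h
  · positivity
  · simpa using Real.rpow_le_rpow_of_exponent_ge h ht1 hα

theorem of_lipschitz (hα : 0 ≤ α) (hα1 : α ≤ 1) (hδ : 0 < δ) (hN : 0 ≤ N)
    (h0 : ∀ x ∈ S, ‖f x‖ ≤ N)
    (h1 : ∀ x ∈ S, ∀ y ∈ S, ‖f x - f y‖ ≤ N / δ * ‖x - y‖) :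
    HolderBound α δ S (2 * N) f := by
  refine of_local hα hδ hN h0 fun x hx y hy hxy => (h1 x hx y hy).trans ?_
  have : ‖x - y‖ / δ ≤ (‖x - y‖ / δ) ^ α :=
    self_le_rpow hα1 (by positivity) ((div_le_one hδ).2 hxy)
  calc N / δ * ‖x - y‖ = N * (‖x - y‖ / δ) := by ring
    _ ≤ N * (‖x - y‖ / δ) ^ α := by gcongr
    _ ≤ 2 * N * (‖x - y‖ / δ) ^ α := by gcongr; linarith

variable [NormedSpace ℝ X] [NormedSpace ℝ Y] [NormedSpace ℝ Z]

theorem bilin (B : X →L[ℝ] Y →L[ℝ] Z) {g : ℂ → Y}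
    (hf : HolderBound α δ S N f) (hg : HolderBound α δ S M g) :
    HolderBound α δ S (2 * ‖B‖ * N * M) (fun x => B (f x) (g x)) := by
  have h0 : ∀ x ∈ S, ‖B (f x) (g x)‖ ≤ ‖B‖ * N * M := fun x hx =>
    B.le_of_opNorm₂_le_of_le le_rfl (hf.1 x hx) (hg.1 x hx)
  refine ⟨fun x hx => (h0 x hx).trans ?_, fun x hx y hy => ?_⟩
  · have := (norm_nonneg _).trans (h0 x hx)
    linarith
  · have e : B (f x) (g x) - B (f y) (g y) = B (f x - f y) (g x) + B (f y) (g x - g y) := by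
      simp
    rw [e]
    have h1 := B.le_of_opNorm₂_le_of_le le_rfl (hf.2 x hx y hy) (hg.1 x hx)
    have h2 := B.le_of_opNorm₂_le_of_le le_rfl (hf.1 y hy) (hg.2 x hx y hy)
    refine (norm_add_le _ _).trans ((add_le_add h1 h2).trans (le_of_eq ?_))
    ring

end HolderBound

section Composition

variable {V X : Type*} [NormedAddCommGroup V] [NormedSpace ℝ V] [NormedAddCommGroup X]
  [NormedSpace ℝ X]

/-- Second-order difference estimate for a map with bounded and Lipschitz derivative. -/
theorem norm_four_point_le {F : V → X} {C : ℝ} (hF : Differentiable ℝ F)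
    (h1 : ∀ x, ‖fderiv ℝ F x‖ ≤ C) (h2 : ∀ x y, ‖fderiv ℝ F x - fderiv ℝ F y‖ ≤ C * ‖x - y‖)
    (a b c d : V) :
    ‖(F a - F b) - (F c - F d)‖ ≤
      C * ‖(a - b) - (c - d)‖ + C * (‖b - d‖ + ‖a - c‖) * ‖c - d‖ := by
  have hC : 0 ≤ C := (norm_nonneg _).trans (h1 0)
  let G : ℝ → X := fun t => F (b + t • (a - b)) - F (d + t • (c - d))
  have hG : ∀ t, HasDerivAt G (fderiv ℝ F (b + t • (a - b)) (a - b)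
      - fderiv ℝ F (d + t • (c - d)) (c - d)) t := by
    intro t
    have hl : ∀ p q : V, HasDerivAt (fun t : ℝ => p + t • q) q t := fun p q => by
      simpa using ((hasDerivAt_id t).smul_const q).const_add p
    exact ((hF _).hasFDerivAt.comp_hasDerivAt t (hl b (a - b))).sub
      ((hF _).hasFDerivAt.comp_hasDerivAt t (hl d (c - d)))
  have hmv := norm_image_sub_le_of_norm_deriv_le_segment_01' (f := G)
    (C := C * ‖(a - b) - (c - d)‖ + C * (‖b - d‖ + ‖a - c‖) * ‖c - d‖)
    (fun t _ => (hG t).hasDerivWithinAt) ?_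
  · have e : G 1 - G 0 = (F a - F b) - (F c - F d) := by
      simp only [G, one_smul, zero_smul, add_zero, add_sub_cancel]; abel
    rwa [e] at hmv
  · intro t ht
    have e : fderiv ℝ F (b + t • (a - b)) (a - b) - fderiv ℝ F (d + t • (c - d)) (c - d)
        = fderiv ℝ F (b + t • (a - b)) ((a - b) - (c - d))
          + (fderiv ℝ F (b + t • (a - b)) - fderiv ℝ F (d + t • (c - d))) (c - d) := by
      simp
    rw [e]
    refine (norm_add_le _ _).trans (add_le_add ?_ ?_)
    · exact ContinuousLinearMap.le_of_opNorm_le _ (h1 _) _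
    · refine ContinuousLinearMap.le_of_opNorm_le _ ((h2 _ _).trans ?_) _
      gcongr
      have e2 : b + t • (a - b) - (d + t • (c - d)) = (1 - t) • (b - d) + t • (a - c) := by
        module
      rw [e2]
      refine (norm_add_le _ _).trans (add_le_add ?_ ?_)
      · rw [norm_smul, Real.norm_of_nonneg (by linarith [ht.2])]
        exact mul_le_of_le_one_left (norm_nonneg _) (by linarith [ht.1])
      · rw [norm_smul, Real.norm_of_nonneg ht.1]
        exact mul_le_of_le_one_left (norm_nonneg _) ht.2.le

variable {E : Type*} [NormedAddCommGroup E] [NormedSpace ℝ E]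

/-- Superposition with a map having bounded Lipschitz derivative is Lipschitz on the unit ball of
the scaled Hölder space, uniformly in the scale. -/
theorem HolderBound.comp_sub {F : ℂ × E → X} {C α δ M D : ℝ} (hF : Differentiable ℝ F)
    (h1 : ∀ x, ‖fderiv ℝ F x‖ ≤ C) (h2 : ∀ x y, ‖fderiv ℝ F x - fderiv ℝ F y‖ ≤ C * ‖x - y‖)
    (hα : 0 ≤ α) (hα1 : α ≤ 1) (hδ : 0 < δ) (hδ1 : δ ≤ 1) (hM : M ≤ 1) {w₁ w₂ : ℂ → E}
    (hw₁ : HolderBound α δ univ M w₁) (hw₂ : HolderBound α δ univ M w₂)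
    (hD : HolderBound α δ univ D (fun x => w₁ x - w₂ x)) :
    HolderBound α δ univ (5 * C * D) (fun x => F (x, w₁ x) - F (x, w₂ x)) := by
  have hC : 0 ≤ C := (norm_nonneg _).trans (h1 0)
  have hD0 : 0 ≤ D := (norm_nonneg _).trans (hD.1 0 trivial)
  have e0 : ∀ (x : ℂ) (a b : E), ‖((x, a) : ℂ × E) - (x, b)‖ = ‖a - b‖ := fun x a b => by
    simp [Prod.norm_def]
  have hsup : ∀ x ∈ (univ : Set ℂ), ‖F (x, w₁ x) - F (x, w₂ x)‖ ≤ 5 / 2 * C * D := by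
    intro x _
    have := convex_univ.norm_image_sub_le_of_norm_fderiv_le (𝕜 := ℝ) (fun z _ => hF z)
      (fun z _ => h1 z) (mem_univ (x, w₂ x)) (mem_univ (x, w₁ x))
    rw [e0] at this
    have h3 : C * ‖w₁ x - w₂ x‖ ≤ C * D := by gcongr; exact hD.1 x trivial
    nlinarith [mul_nonneg hC hD0]
  have key := HolderBound.of_local (N := 5 / 2 * C * D) hα hδ (by positivity) hsup ?_
  · convert key using 1; ring
  intro x _ y _ hxy
  set τ := (‖x - y‖ / δ) ^ α with hτ
  have hτ0 : 0 ≤ τ := by positivity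
  have hxyτ : ‖x - y‖ ≤ τ := by
    have h3 : ‖x - y‖ / δ ≤ τ :=
      HolderBound.self_le_rpow hα1 (by positivity) ((div_le_one hδ).2 hxy)
    rw [div_le_iff₀ hδ] at h3
    nlinarith
  have hp : ∀ w : ℂ → E, HolderBound α δ univ M w → ‖((x, w x) : ℂ × E) - (y, w y)‖ ≤ τ := by
    intro w hw
    rw [Prod.mk_sub_mk, Prod.norm_mk]
    refine max_le hxyτ ((hw.2 x trivial y trivial).trans ?_)
    exact mul_le_of_le_one_left hτ0 hM
  have h4 := norm_four_point_le hF h1 h2 (x, w₁ x) (x, w₂ x) (y, w₁ y) (y, w₂ y)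
  have e3 : ‖(((x, w₁ x) : ℂ × E) - (x, w₂ x)) - ((y, w₁ y) - (y, w₂ y))‖ =
      ‖(w₁ x - w₂ x) - (w₁ y - w₂ y)‖ := by
    simp [Prod.norm_def]
  rw [e3, e0] at h4
  refine h4.trans ?_
  have a1 : C * ‖(w₁ x - w₂ x) - (w₁ y - w₂ y)‖ ≤ C * (D * τ) := by
    gcongr; exact hD.2 x trivial y trivial
  have a2 : C * (‖((x, w₂ x) : ℂ × E) - (y, w₂ y)‖ + ‖((x, w₁ x) : ℂ × E) - (y, w₁ y)‖)
      * ‖w₁ y - w₂ y‖ ≤ C * (τ + τ) * D := by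
    gcongr
    · exact hp _ hw₂
    · exact hp _ hw₁
    · exact hD.1 y trivial
  have : 0 ≤ C * D * τ := by positivity
  nlinarith

end Composition

/-! ### Radial integrals and convolution kernels on the plane -/

section Kernels

open MeasureTheory Filter Topology ComplexConjugate

theorem integrable_norm_rpow_div {s ε : ℝ} (hs : -2 < s) (hs0 : s < 0) (hε : 0 < ε) :
    Integrable (fun ξ : ℂ => ‖ξ‖ ^ s / (‖ξ‖ ^ 2 + ε ^ 2)) := by
  have h := integrable_fun_norm_addHaar (E := ℂ) (volume : Measure ℂ)
    (f := fun r : ℝ => r ^ s / (r ^ 2 + ε ^ 2))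
  rw [h, Complex.finrank_real_complex]
  have hm : AEStronglyMeasurable (fun y : ℝ => y ^ (2 - 1) • (y ^ s / (y ^ 2 + ε ^ 2))) volume := by
    refine Measurable.aestronglyMeasurable ?_
    fun_prop
  have e : Ioi (0 : ℝ) = Ioo 0 2 ∪ Ioi 1 := by
    ext x; simp only [mem_Ioi, mem_union, mem_Ioo]; constructor
    · intro hx; by_cases h : x < 2
      · exact Or.inl ⟨hx, h⟩
      · exact Or.inr (by linarith)
    · rintro (h | h) <;> linarith [h]
  rw [e]
  refine IntegrableOn.union ?_ ?_
  · have h1 : IntegrableOn (fun x : ℝ => (ε ^ 2)⁻¹ * x ^ (s + 1)) (Ioo 0 2) :=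
      ((intervalIntegral.integrableOn_Ioo_rpow_iff (by norm_num)).2 (by linarith)).const_mul _
    refine Integrable.mono' h1 hm.restrict ?_
    refine (ae_restrict_mem measurableSet_Ioo).mono fun x hx => ?_
    have hx0 : 0 < x := hx.1
    rw [Real.rpow_add hx0, Real.rpow_one, Real.norm_of_nonneg (by positivity), smul_eq_mul]
    simp only [Nat.add_one_sub_one, pow_one]
    rw [div_eq_mul_inv]
    have : (x ^ 2 + ε ^ 2)⁻¹ ≤ (ε ^ 2)⁻¹ := by gcongr; nlinarith
    calc x * (x ^ s * (x ^ 2 + ε ^ 2)⁻¹) ≤ x * (x ^ s * (ε ^ 2)⁻¹) := by gcongr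
      _ = _ := by ring
  · have h1 : IntegrableOn (fun x : ℝ => x ^ (s - 1)) (Ioi 1) :=
      integrableOn_Ioi_rpow_of_lt (by linarith) one_pos
    refine Integrable.mono' h1 hm.restrict ?_
    refine (ae_restrict_mem measurableSet_Ioi).mono fun x hx => ?_
    have hx0 : 0 < x := one_pos.trans hx
    rw [Real.rpow_sub hx0, Real.rpow_one, Real.norm_of_nonneg (by positivity), smul_eq_mul]
    simp only [Nat.add_one_sub_one, pow_one]
    rw [div_eq_mul_inv, div_eq_mul_inv]
    have : (x ^ 2 + ε ^ 2)⁻¹ ≤ (x ^ 2)⁻¹ := by gcongr; nlinarith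
    calc x * (x ^ s * (x ^ 2 + ε ^ 2)⁻¹) ≤ x * (x ^ s * (x ^ 2)⁻¹) := by gcongr
      _ = _ := by field_simp

/-- The power of the scale comes from the substitution `ξ ↦ ε ξ`. -/
theorem integral_norm_rpow_div (s : ℝ) {ε : ℝ} (hε : 0 < ε) :
    ∫ ξ : ℂ, ‖ξ‖ ^ s / (‖ξ‖ ^ 2 + ε ^ 2) = ε ^ s * ∫ ξ : ℂ, ‖ξ‖ ^ s / (‖ξ‖ ^ 2 + 1) := by
  have h := Measure.integral_comp_smul (volume : Measure ℂ)
    (fun ξ : ℂ => ‖ξ‖ ^ s / (‖ξ‖ ^ 2 + ε ^ 2)) ε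
  rw [Complex.finrank_real_complex, abs_of_pos (by positivity)] at h
  have e : ∀ ξ : ℂ, ‖ε • ξ‖ ^ s / (‖ε • ξ‖ ^ 2 + ε ^ 2) =
      (ε ^ s / ε ^ 2) * (‖ξ‖ ^ s / (‖ξ‖ ^ 2 + 1)) := by
    intro ξ
    rw [norm_smul, Real.norm_of_nonneg hε.le, Real.mul_rpow hε.le (norm_nonneg _)]
    field_simp
  simp_rw [e] at h
  rw [integral_const_mul, smul_eq_mul] at h
  have h2 : (0 : ℝ) < ε ^ 2 := by positivity
  field_simp at h
  linarith

theorem integral_eq_zero_of_odd {k : ℂ → ℂ}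
    (hk : ∀ ξ, k (-ξ) = -k ξ) : ∫ ξ, k ξ = 0 := by
  have h := integral_neg_eq_self k (volume : Measure ℂ)
  simp_rw [hk, integral_neg] at h
  exact self_eq_neg.mp h.symm

theorem integral_eq_zero_of_rotate {k : ℂ → ℂ} (hk : ∀ ξ, k (Complex.I * ξ) = -k ξ) :
    ∫ ξ, k ξ = 0 := by
  let c : Circle := ⟨Complex.I, by simp [Submonoid.unitSphere]⟩
  have h := (rotation c).measurePreserving.integral_comp
    (rotation c).toHomeomorph.measurableEmbedding k
  have e : ∀ ξ, k (rotation c ξ) = -k ξ := fun ξ => by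
    rw [rotation_apply]; exact hk ξ
  simp_rw [e, integral_neg] at h
  exact self_eq_neg.mp h.symm

variable {E : Type*} [NormedAddCommGroup E] [NormedSpace ℂ E]

/-- Averaging a Hölder function against a kernel of total mass `m` reproduces `m` times the function
up to the first `α`-moment of the kernel. -/
theorem norm_integral_kernel_sub_le [CompleteSpace E] {k : ℂ → ℂ} {κ : ℂ → ℝ} {m : ℂ}
    {g : ℂ → E} {α H : ℝ} (hk : Integrable k) (hm : ∫ ξ, k ξ = m) (hκ : Integrable κ)
    (hkκ : ∀ ξ, ‖k ξ‖ * ‖ξ‖ ^ α ≤ κ ξ) (hg : Continuous g) (hgc : HasCompactSupport g)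
    (hH : 0 ≤ H) (hgH : ∀ x y, ‖g x - g y‖ ≤ H * ‖x - y‖ ^ α) (z : ℂ) :
    ‖(∫ ζ, k (z - ζ) • g ζ) - m • g z‖ ≤ H * ∫ ξ, κ ξ := by
  have hkz : Integrable (fun ζ => k (z - ζ)) := hk.comp_sub_left z
  obtain ⟨B, hB⟩ := hgc.exists_bound_of_continuous hg
  have h1 : Integrable (fun ζ => k (z - ζ) • g ζ) := by
    refine (hkz.norm.mul_const B).mono' (hkz.1.smul hg.aestronglyMeasurable) ?_
    refine Eventually.of_forall fun ζ => ?_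
    rw [norm_smul]; gcongr; exact hB ζ
  have h2 : Integrable (fun ζ => k (z - ζ) • g z) := hkz.smul_const _
  have h3 : m • g z = ∫ ζ, k (z - ζ) • g z := by
    rw [integral_smul_const, integral_sub_left_eq_self, hm]
  rw [h3, ← integral_sub h1 h2, ← integral_const_mul,
    ← integral_sub_left_eq_self (fun ξ => H * κ ξ) volume z]
  refine norm_integral_le_of_norm_le ((hκ.const_mul H).comp_sub_left z)
    (Eventually.of_forall fun ζ => ?_)
  rw [← smul_sub, norm_smul]
  calc ‖k (z - ζ)‖ * ‖g ζ - g z‖ ≤ ‖k (z - ζ)‖ * (H * ‖z - ζ‖ ^ α) := by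
        gcongr; rw [norm_sub_rev z]; exact hgH ζ z
    _ = H * (‖k (z - ζ)‖ * ‖z - ζ‖ ^ α) := by ring
    _ ≤ _ := by gcongr; exact hkκ _

/-- Differentiation of a convolution with a `C¹` kernel under the integral sign. -/
theorem hasFDerivAt_integral_kernel {k : ℂ → ℂ} (hk : ContDiff ℝ 1 k) {g : ℂ → E}
    (hg : Continuous g) (hgc : HasCompactSupport g) (z : ℂ) :
    HasFDerivAt (fun z => ∫ ζ, k (z - ζ) • g ζ)
      (∫ ζ, ((ContinuousLinearMap.lsmul ℝ ℂ).flip (g ζ)).comp (fderiv ℝ k (z - ζ))) z := by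
  have hk' : Continuous (fderiv ℝ k) := hk.continuous_fderiv one_ne_zero
  have hcont : ∀ z, Continuous (fun ζ => k (z - ζ) • g ζ) := fun z =>
    (hk.continuous.comp (by fun_prop)).smul hg
  have hcont' : Continuous (fun p : ℂ × ℂ =>
      ((ContinuousLinearMap.lsmul ℝ ℂ).flip (g p.2)).comp (fderiv ℝ k (p.1 - p.2))) := by
    fun_prop
  obtain ⟨B, hB⟩ := ((isCompact_closedBall z 1).prod hgc).exists_bound_of_continuousOn
    hcont'.continuousOn
  have hi : ∀ z, Integrable (fun ζ => k (z - ζ) • g ζ) := fun z =>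
    (hcont z).integrable_of_hasCompactSupport hgc.smul_left
  refine hasFDerivAt_integral_of_dominated_of_fderiv_le
    (F := fun z ζ => k (z - ζ) • g ζ)
    (F' := fun z ζ => ((ContinuousLinearMap.lsmul ℝ ℂ).flip (g ζ)).comp (fderiv ℝ k (z - ζ)))
    (bound := (tsupport g).indicator fun _ => B)
    (Metric.closedBall_mem_nhds z one_pos)
    (Eventually.of_forall fun z => (hi z).1) (hi z)
    (hcont'.comp (by fun_prop : Continuous fun ζ : ℂ => (z, ζ))).aestronglyMeasurable
    (Eventually.of_forall fun ζ x hx => ?_)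
    ((integrable_indicator_iff (isClosed_tsupport g).measurableSet).2
      (integrableOn_const hgc.measure_lt_top.ne))
    (Eventually.of_forall fun ζ x _ => ?_)
  · by_cases h : ζ ∈ tsupport g
    · rw [indicator_of_mem h]
      exact hB (x, ζ) ⟨hx, h⟩
    · rw [indicator_of_notMem h, image_eq_zero_of_notMem_tsupport h]
      simp
  · have h1 : HasFDerivAt (fun x => k (x - ζ)) (fderiv ℝ k (x - ζ)) x := by
      have := ((hk.differentiable one_ne_zero (x - ζ)).hasFDerivAt).comp x
        ((hasFDerivAt_id x).sub_const ζ)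
      rwa [ContinuousLinearMap.comp_id] at this
    convert h1.smul_const (g ζ) using 1
    ext v
    simp

end Kernels

section Regularized

open MeasureTheory Filter Topology ComplexConjugate

/-- A smooth regularization, at the length scale `ε`, of the kernel `1 / ζ`. -/
noncomputable def regKernel (ε : ℝ) (ζ : ℂ) : ℂ := conj ζ * (ζ * conj ζ + (ε : ℂ) ^ 2)⁻¹

/-- The Wirtinger derivative `∂/∂ζ` of `regKernel ε`. -/
noncomputable def regKernelDz (ε : ℝ) (ζ : ℂ) : ℂ :=
  -conj ζ ^ 2 * ((ζ * conj ζ + (ε : ℂ) ^ 2)⁻¹) ^ 2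

/-- The Wirtinger derivative `∂/∂(conj ζ)` of `regKernel ε`, an approximate identity of mass `π`. -/
noncomputable def regKernelDzbar (ε : ℝ) (ζ : ℂ) : ℂ :=
  (ε : ℂ) ^ 2 * ((ζ * conj ζ + (ε : ℂ) ^ 2)⁻¹) ^ 2

theorem mul_conj_add_sq (ε : ℝ) (ζ : ℂ) :
    ζ * conj ζ + (ε : ℂ) ^ 2 = ((‖ζ‖ ^ 2 + ε ^ 2 : ℝ) : ℂ) := by
  rw [Complex.mul_conj']; push_cast; rfl

variable {ε : ℝ}

theorem mul_conj_add_sq_ne_zero (hε : 0 < ε) (ζ : ℂ) : ζ * conj ζ + (ε : ℂ) ^ 2 ≠ 0 := by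
  rw [mul_conj_add_sq]
  have : 0 < ‖ζ‖ ^ 2 + ε ^ 2 := by positivity
  exact_mod_cast this.ne'

theorem contDiff_mul_conj_add_sq : ContDiff ℝ 1 (fun ζ : ℂ => ζ * conj ζ + (ε : ℂ) ^ 2) :=
  (contDiff_id.mul Complex.conjCLE.contDiff).add contDiff_const

theorem contDiff_regKernel (hε : 0 < ε) : ContDiff ℝ 1 (regKernel ε) :=
  Complex.conjCLE.contDiff.mul (contDiff_mul_conj_add_sq.inv (mul_conj_add_sq_ne_zero hε))

theorem contDiff_regKernelDz (hε : 0 < ε) : ContDiff ℝ 1 (regKernelDz ε) :=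
  (Complex.conjCLE.contDiff.pow 2).neg.mul
    ((contDiff_mul_conj_add_sq.inv (mul_conj_add_sq_ne_zero hε)).pow 2)

theorem continuous_regKernelDzbar (hε : 0 < ε) : Continuous (regKernelDzbar ε) :=
  continuous_const.mul
    ((contDiff_mul_conj_add_sq.continuous.inv₀ (mul_conj_add_sq_ne_zero hε)).pow 2)

theorem hasDerivAt_line (ζ v : ℂ) : HasDerivAt (fun t : ℝ => ζ + t * v) v 0 := by
  simpa using ((Complex.ofRealCLM.hasDerivAt (x := (0 : ℝ))).mul_const v).const_add ζ

theorem hasDerivAt_line_conj (ζ v : ℂ) :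
    HasDerivAt (fun t : ℝ => conj ζ + t * conj v) (conj v) 0 := hasDerivAt_line _ _

theorem fderiv_apply_eq_of_line {k : ℂ → ℂ} {ζ v d : ℂ} (hk : DifferentiableAt ℝ k ζ)
    (hd : HasDerivAt (fun t : ℝ => k (ζ + t * v)) d 0) : fderiv ℝ k ζ v = d := by
  have h1 : HasFDerivAt k (fderiv ℝ k ζ) (ζ + ((0 : ℝ) : ℂ) * v) := by
    simpa using hk.hasFDerivAt
  exact (h1.comp_hasDerivAt (0 : ℝ) (hasDerivAt_line ζ v)).unique hd

theorem hasDerivAt_inv_line (hε : 0 < ε) (ζ v : ℂ) :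
    HasDerivAt (fun t : ℝ => ((ζ + t * v) * (conj ζ + t * conj v) + (ε : ℂ) ^ 2)⁻¹)
      (-(v * conj ζ + ζ * conj v) * ((ζ * conj ζ + (ε : ℂ) ^ 2)⁻¹) ^ 2) 0 := by
  have h := (((hasDerivAt_line ζ v).mul (hasDerivAt_line_conj ζ v)).add_const ((ε : ℂ) ^ 2)).fun_inv
    (by simpa using mul_conj_add_sq_ne_zero hε ζ)
  refine h.congr_deriv ?_
  simp [div_eq_mul_inv]

theorem fderiv_regKernel (hε : 0 < ε) (ζ v : ℂ) :
    fderiv ℝ (regKernel ε) ζ v = regKernelDz ε ζ * v + regKernelDzbar ε ζ * conj v := by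
  refine fderiv_apply_eq_of_line ((contDiff_regKernel hε).differentiable one_ne_zero ζ) ?_
  have h := (hasDerivAt_line_conj ζ v).fun_mul (hasDerivAt_inv_line hε ζ v)
  simp only [regKernel, map_add, map_mul, Complex.conj_ofReal]
  refine h.congr_deriv ?_
  have := mul_conj_add_sq_ne_zero hε ζ
  simp only [regKernelDz, regKernelDzbar, Complex.ofReal_zero, zero_mul, add_zero]
  field_simp
  ring

theorem fderiv_regKernelDz (hε : 0 < ε) (ζ v : ℂ) :
    fderiv ℝ (regKernelDz ε) ζ v =
      -(2 * conj ζ * conj v) * ((ζ * conj ζ + (ε : ℂ) ^ 2)⁻¹) ^ 2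
      + 2 * conj ζ ^ 2 * (v * conj ζ + ζ * conj v) * ((ζ * conj ζ + (ε : ℂ) ^ 2)⁻¹) ^ 3 := by
  refine fderiv_apply_eq_of_line ((contDiff_regKernelDz hε).differentiable one_ne_zero ζ) ?_
  have h := ((hasDerivAt_line_conj ζ v).fun_pow 2).fun_neg.fun_mul
    ((hasDerivAt_inv_line hε ζ v).fun_pow 2)
  simp only [regKernelDz, map_add, map_mul, Complex.conj_ofReal]
  refine h.congr_deriv ?_
  simp only [Complex.ofReal_zero, zero_mul, add_zero]
  push_cast
  ring

theorem norm_inv_mul_conj_add_sq (ε : ℝ) (ζ : ℂ) :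
    ‖(ζ * conj ζ + (ε : ℂ) ^ 2)⁻¹‖ = (‖ζ‖ ^ 2 + ε ^ 2)⁻¹ := by
  rw [mul_conj_add_sq, norm_inv, Complex.norm_real, Real.norm_of_nonneg (by positivity)]

theorem norm_regKernelDz (ε : ℝ) (ζ : ℂ) :
    ‖regKernelDz ε ζ‖ = ‖ζ‖ ^ 2 * ((‖ζ‖ ^ 2 + ε ^ 2)⁻¹) ^ 2 := by
  rw [regKernelDz, norm_mul, norm_neg, norm_pow, norm_pow, norm_inv_mul_conj_add_sq,
    RCLike.norm_conj]

theorem norm_regKernelDzbar (ε : ℝ) (ζ : ℂ) :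
    ‖regKernelDzbar ε ζ‖ = ε ^ 2 * ((‖ζ‖ ^ 2 + ε ^ 2)⁻¹) ^ 2 := by
  rw [regKernelDzbar, norm_mul, norm_pow, norm_pow, norm_inv_mul_conj_add_sq,
    Complex.norm_real, Real.norm_eq_abs, sq_abs]

theorem norm_regKernel_le (ε : ℝ) (ζ : ℂ) : ‖regKernel ε ζ‖ ≤ ‖ζ‖⁻¹ := by
  rw [regKernel, norm_mul, norm_inv_mul_conj_add_sq, RCLike.norm_conj]
  rcases (norm_nonneg ζ).eq_or_lt with h | h
  · rw [← h]; simp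
  · rw [mul_inv_le_iff₀ (by positivity)]
    have : ‖ζ‖ ≤ ‖ζ‖⁻¹ * ‖ζ‖ ^ 2 := by field_simp; rfl
    have h2 : 0 ≤ ‖ζ‖⁻¹ * ε ^ 2 := by positivity
    linarith

theorem norm_regKernelDz_le (hε : 0 < ε) (ζ : ℂ) : ‖regKernelDz ε ζ‖ ≤ ε⁻¹ * ‖ζ‖⁻¹ := by
  rw [norm_regKernelDz]
  rcases (norm_nonneg ζ).eq_or_lt with h | h
  · rw [← h]; simp
  · set r := ‖ζ‖
    have h1 : r ^ 2 * (r ^ 2 + ε ^ 2)⁻¹ ≤ 1 := by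
      rw [mul_inv_le_iff₀ (by positivity)]; nlinarith
    have h2 : (r ^ 2 + ε ^ 2)⁻¹ ≤ ε⁻¹ * r⁻¹ := by
      rw [← mul_inv]; gcongr; nlinarith [mul_pos h hε, sq_nonneg (r - ε)]
    calc r ^ 2 * ((r ^ 2 + ε ^ 2)⁻¹) ^ 2 = r ^ 2 * (r ^ 2 + ε ^ 2)⁻¹ * (r ^ 2 + ε ^ 2)⁻¹ := by ring
      _ ≤ 1 * (ε⁻¹ * r⁻¹) := by gcongr
      _ = _ := one_mul _

theorem regKernelDz_I_mul (ε : ℝ) (ζ : ℂ) :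
    regKernelDz ε (Complex.I * ζ) = -regKernelDz ε ζ := by
  have e : Complex.I * ζ * conj (Complex.I * ζ) = ζ * conj ζ := by
    simp only [map_mul, Complex.conj_I]
    linear_combination (-ζ * conj ζ) * Complex.I_sq
  rw [regKernelDz, regKernelDz, e]
  simp only [map_mul, Complex.conj_I]
  linear_combination (-(conj ζ ^ 2 * ((ζ * conj ζ + (ε : ℂ) ^ 2)⁻¹) ^ 2)) * Complex.I_sq

theorem fderiv_regKernelDz_neg (hε : 0 < ε) (ζ v : ℂ) :
    fderiv ℝ (regKernelDz ε) (-ζ) v = -fderiv ℝ (regKernelDz ε) ζ v := by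
  rw [fderiv_regKernelDz hε, fderiv_regKernelDz hε]
  simp only [map_neg, neg_mul_neg]
  ring

theorem norm_fderiv_regKernelDz_le (hε : 0 < ε) (ζ v : ℂ) :
    ‖fderiv ℝ (regKernelDz ε) ζ v‖ ≤ 6 * ‖v‖ * (‖ζ‖ * ((‖ζ‖ ^ 2 + ε ^ 2)⁻¹) ^ 2) := by
  rw [fderiv_regKernelDz hε]
  set D := (‖ζ‖ ^ 2 + ε ^ 2)⁻¹ with hD
  have hD0 : 0 ≤ D := by positivity
  have hrD : ‖ζ‖ ^ 2 * D ≤ 1 := by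
    rw [hD, mul_inv_le_iff₀ (by positivity)]; nlinarith
  have h1 : ‖-(2 * conj ζ * conj v) * ((ζ * conj ζ + (ε : ℂ) ^ 2)⁻¹) ^ 2‖
      = 2 * ‖ζ‖ * ‖v‖ * D ^ 2 := by
    rw [norm_mul, norm_neg, norm_pow, norm_inv_mul_conj_add_sq, norm_mul, norm_mul]
    simp [hD]
  have h2 : ‖2 * conj ζ ^ 2 * (v * conj ζ + ζ * conj v) * ((ζ * conj ζ + (ε : ℂ) ^ 2)⁻¹) ^ 3‖
      ≤ 2 * ‖ζ‖ ^ 2 * (‖v‖ * ‖ζ‖ + ‖ζ‖ * ‖v‖) * D ^ 3 := by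
    rw [norm_mul, norm_pow _ 3, norm_inv_mul_conj_add_sq, norm_mul, norm_mul, norm_pow]
    simp only [Complex.norm_ofNat, RCLike.norm_conj]
    gcongr
    refine (norm_add_le _ _).trans (le_of_eq ?_)
    simp
  refine (norm_add_le _ _).trans ((add_le_add h1.le h2).trans ?_)
  have h3 : 0 ≤ ‖ζ‖ * ‖v‖ * D ^ 2 := by positivity
  nlinarith

theorem norm_regKernelDz_sub_le {ε' : ℝ} (hε : 0 < ε) (hε' : 0 < ε') (h : ε' ≤ ε) (ζ : ℂ) :
    ‖regKernelDz ε ζ - regKernelDz ε' ζ‖ ≤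
      2 * ε ^ 2 * (‖ζ‖ ^ 2 * ((‖ζ‖ ^ 2 + ε' ^ 2)⁻¹) ^ 2 * (‖ζ‖ ^ 2 + ε ^ 2)⁻¹) := by
  have e : regKernelDz ε ζ - regKernelDz ε' ζ = conj ζ ^ 2 *
      (((((‖ζ‖ ^ 2 + ε' ^ 2)⁻¹) ^ 2 - ((‖ζ‖ ^ 2 + ε ^ 2)⁻¹) ^ 2 : ℝ)) : ℂ) := by
    simp only [regKernelDz, mul_conj_add_sq]
    push_cast
    ring
  rw [e, norm_mul, norm_pow, RCLike.norm_conj, Complex.norm_real]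
  have hx : 0 < ‖ζ‖ ^ 2 + ε' ^ 2 := by positivity
  have hxy : ‖ζ‖ ^ 2 + ε' ^ 2 ≤ ‖ζ‖ ^ 2 + ε ^ 2 := by gcongr
  have hyx : ‖ζ‖ ^ 2 + ε ^ 2 - (‖ζ‖ ^ 2 + ε' ^ 2) ≤ ε ^ 2 := by nlinarith
  generalize ‖ζ‖ ^ 2 + ε' ^ 2 = x at *
  generalize ‖ζ‖ ^ 2 + ε ^ 2 = y at *
  have hy : 0 < y := hx.trans_le hxy
  have hinv : y⁻¹ ≤ x⁻¹ := by gcongr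
  have hy0 : 0 < y⁻¹ := by positivity
  rw [Real.norm_of_nonneg (by nlinarith)]
  have key : (x⁻¹) ^ 2 - (y⁻¹) ^ 2 ≤ 2 * ε ^ 2 * ((x⁻¹) ^ 2 * y⁻¹) := by
    have e2 : (x⁻¹) ^ 2 - (y⁻¹) ^ 2 = (y - x) * (x + y) * (x⁻¹) ^ 2 * (y⁻¹) ^ 2 := by
      field_simp; ring
    have e3 : 2 * ε ^ 2 * ((x⁻¹) ^ 2 * y⁻¹) = ε ^ 2 * (2 * y) * (x⁻¹) ^ 2 * (y⁻¹) ^ 2 := by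
      field_simp
    rw [e2, e3]
    have : 0 ≤ y - x := by linarith
    gcongr
    linarith
  calc ‖ζ‖ ^ 2 * ((x⁻¹) ^ 2 - (y⁻¹) ^ 2) ≤ ‖ζ‖ ^ 2 * (2 * ε ^ 2 * ((x⁻¹) ^ 2 * y⁻¹)) := by gcongr
    _ = _ := by ring

end Regularized

/-! ### The Cauchy transform on Hölder spaces -/

section KernelAverages

open MeasureTheory Filter Topology ComplexConjugate

variable {E : Type*} [NormedAddCommGroup E] [NormedSpace ℂ E]

/-- The integral `∫ |ξ|^s / (|ξ|² + 1)`, finite for `-2 < s < 0`. -/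
noncomputable def radialMoment (s : ℝ) : ℝ := ∫ ξ : ℂ, ‖ξ‖ ^ s / (‖ξ‖ ^ 2 + 1)

theorem radialMoment_nonneg (s : ℝ) : 0 ≤ radialMoment s :=
  integral_nonneg fun ξ => by positivity

theorem integral_regKernelDzbar {ε : ℝ} (hε : 0 < ε) : ∫ ξ, regKernelDzbar ε ξ = Real.pi := by
  have e : ∀ ξ, regKernelDzbar ε ξ = ((ε ^ 2 * ((‖ξ‖ ^ 2 + ε ^ 2)⁻¹) ^ 2 : ℝ) : ℂ) := fun ξ => by
    simp only [regKernelDzbar, mul_conj_add_sq]; push_cast; rfl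
  simp_rw [e]
  rw [integral_complex_ofReal, integral_fun_norm_addHaar volume
    (fun r : ℝ => ε ^ 2 * ((r ^ 2 + ε ^ 2)⁻¹) ^ 2), Complex.finrank_real_complex]
  have hd : ∀ x : ℝ, HasDerivAt (fun r : ℝ => -(ε ^ 2 / 2) * (r ^ 2 + ε ^ 2)⁻¹)
      (x ^ (2 - 1) • (ε ^ 2 * ((x ^ 2 + ε ^ 2)⁻¹) ^ 2)) x := fun x => by
    have h := ((((hasDerivAt_id x).fun_pow 2).add_const (ε ^ 2)).fun_inv
      (by positivity)).const_mul (-(ε ^ 2 / 2))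
    refine h.congr_deriv ?_
    simp
    field_simp
  have hlim : Tendsto (fun r : ℝ => -(ε ^ 2 / 2) * (r ^ 2 + ε ^ 2)⁻¹) atTop (𝓝 0) := by
    have h : Tendsto (fun r : ℝ => (r ^ 2 + ε ^ 2)⁻¹) atTop (𝓝 0) := tendsto_inv_atTop_zero.comp
      (tendsto_atTop_add_const_right _ _ (tendsto_pow_atTop two_ne_zero))
    simpa using h.const_mul (-(ε ^ 2 / 2))
  rw [integral_Ioi_of_hasDerivAt_of_nonneg' (fun x _ => hd x)
    (fun x hx => by have : 0 < x := hx; positivity) hlim]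
  have hv : (volume : Measure ℂ).real (Metric.ball 0 1) = Real.pi := by
    simp [Measure.real, Complex.volume_ball]
  rw [hv]
  congr 1
  simp
  field_simp

theorem integrable_of_le_norm_inv_div {k : ℂ → ℂ} {ε C : ℝ} (hε : 0 < ε) (hk : Continuous k)
    (h : ∀ ξ, ξ ≠ 0 → ‖k ξ‖ ≤ C * (‖ξ‖⁻¹ * (‖ξ‖ ^ 2 + ε ^ 2)⁻¹)) : Integrable k := by
  refine ((integrable_norm_rpow_div (s := -1) (by norm_num) (by norm_num) hε).const_mul C).mono'
    hk.aestronglyMeasurable ?_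
  have h0 : ∀ᵐ ξ : ℂ, ξ ≠ 0 := by simp [ae_iff]
  filter_upwards [h0] with ξ hξ
  rw [Real.rpow_neg_one, div_eq_mul_inv]
  exact h ξ hξ

theorem sq_mul_inv_le_one {r ε : ℝ} (hε : 0 < ε) : r ^ 2 * (r ^ 2 + ε ^ 2)⁻¹ ≤ 1 := by
  rw [mul_inv_le_iff₀ (by positivity)]; nlinarith

theorem inv_sq_add_sq_le {r ε : ℝ} (hr : 0 < r) (hε : 0 < ε) :
    (r ^ 2 + ε ^ 2)⁻¹ ≤ ε⁻¹ * r⁻¹ := by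
  rw [← mul_inv]; gcongr; nlinarith [mul_pos hr hε, sq_nonneg (r - ε)]

theorem integral_kernel_fderiv_apply {k : ℂ → ℂ} {g : ℂ → E} (hk : ContDiff ℝ 1 k)
    (hg : Continuous g) (hgc : HasCompactSupport g) (z v : ℂ) :
    (∫ ζ, ((ContinuousLinearMap.lsmul ℝ ℂ).flip (g ζ)).comp (fderiv ℝ k (z - ζ))) v =
      ∫ ζ, fderiv ℝ k (z - ζ) v • g ζ := by
  have hk' : Continuous (fderiv ℝ k) := hk.continuous_fderiv one_ne_zero
  have hcont : Continuous (fun ζ : ℂ =>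
      ((ContinuousLinearMap.lsmul ℝ ℂ).flip (g ζ)).comp (fderiv ℝ k (z - ζ))) := by
    fun_prop
  have hcs : HasCompactSupport (fun ζ : ℂ =>
      ((ContinuousLinearMap.lsmul ℝ ℂ).flip (g ζ)).comp (fderiv ℝ k (z - ζ))) :=
    hgc.mono fun ζ h h0 => h (by simp [h0])
  rw [ContinuousLinearMap.integral_apply (hcont.integrable_of_hasCompactSupport hcs)]
  rfl

variable [CompleteSpace E] {g : ℂ → E} {α H : ℝ}

/-- The `z`-derivatives of the regularized transforms form a Cauchy family as `ε → 0`: the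
difference of two kernels has mean zero, by its symmetry under rotation by a right angle, and its
`α`-moment is of order `ε ^ α`. -/
theorem norm_integral_regKernelDz_sub_le (hα : 0 < α) (hα1 : α < 1) (hg : Continuous g)
    (hgc : HasCompactSupport g) (hH : 0 ≤ H) (hgH : ∀ x y, ‖g x - g y‖ ≤ H * ‖x - y‖ ^ α)
    {ε ε' : ℝ} (hε' : 0 < ε') (h : ε' ≤ ε) (z : ℂ) :
    ‖(∫ ζ, regKernelDz ε (z - ζ) • g ζ) - ∫ ζ, regKernelDz ε' (z - ζ) • g ζ‖ ≤
      H * (2 * radialMoment (α - 2) * ε ^ α) := by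
  have hε : 0 < ε := hε'.trans_le h
  have hint : ∀ {ε}, 0 < ε → Integrable (fun ζ => regKernelDz ε (z - ζ) • g ζ) := fun hε =>
    (((contDiff_regKernelDz hε).continuous.comp (by fun_prop)).smul
      hg).integrable_of_hasCompactSupport hgc.smul_left
  have hk : Integrable (fun ξ => regKernelDz ε ξ - regKernelDz ε' ξ) := by
    refine integrable_of_le_norm_inv_div (C := 2 * ε ^ 2 * ε'⁻¹) hε
      ((contDiff_regKernelDz hε).continuous.sub (contDiff_regKernelDz hε').continuous) fun ξ _ => ?_
    refine (norm_regKernelDz_sub_le hε hε' h ξ).trans ?_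
    have h2 := norm_regKernelDz_le hε' ξ
    rw [norm_regKernelDz] at h2
    calc _ ≤ 2 * ε ^ 2 * (ε'⁻¹ * ‖ξ‖⁻¹ * (‖ξ‖ ^ 2 + ε ^ 2)⁻¹) := by gcongr
      _ = _ := by ring
  have hm : ∫ ξ, (regKernelDz ε ξ - regKernelDz ε' ξ) = 0 :=
    integral_eq_zero_of_rotate fun ξ => by
      rw [regKernelDz_I_mul, regKernelDz_I_mul]; ring
  have hκ := (integrable_norm_rpow_div (s := α - 2) (by linarith) (by linarith) hε).const_mul
    (2 * ε ^ 2)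
  have key := norm_integral_kernel_sub_le hk hm hκ (α := α) (fun ξ => ?_) hg hgc hH hgH z
  · simp_rw [sub_smul] at key
    rw [integral_sub (hint hε) (hint hε'), zero_smul, sub_zero, integral_const_mul,
      integral_norm_rpow_div _ hε] at key
    refine key.trans (le_of_eq ?_)
    rw [Real.rpow_sub hε, Real.rpow_two, radialMoment]
    field_simp
  · rcases (norm_nonneg ξ).eq_or_lt with h0 | h0
    · rw [← h0, Real.zero_rpow hα.ne', mul_zero]; positivity
    · calc _ ≤ 2 * ε ^ 2 * (‖ξ‖ ^ 2 * ((‖ξ‖ ^ 2 + ε' ^ 2)⁻¹) ^ 2 * (‖ξ‖ ^ 2 + ε ^ 2)⁻¹) *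
            ‖ξ‖ ^ α := by gcongr; exact norm_regKernelDz_sub_le hε hε' h ξ
        _ = 2 * ε ^ 2 * ((‖ξ‖ ^ 2 * (‖ξ‖ ^ 2 + ε' ^ 2)⁻¹) ^ 2 * (‖ξ‖ ^ (α - 2) *
            (‖ξ‖ ^ 2 + ε ^ 2)⁻¹)) := by
            rw [Real.rpow_sub h0, Real.rpow_two]; field_simp
        _ ≤ 2 * ε ^ 2 * (1 ^ 2 * (‖ξ‖ ^ (α - 2) * (‖ξ‖ ^ 2 + ε ^ 2)⁻¹)) := by
            gcongr; exact sq_mul_inv_le_one hε'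
        _ = _ := by rw [one_pow, one_mul, div_eq_mul_inv]

/-- The `conj z`-derivatives of the regularized transforms converge uniformly to `π g`. -/
theorem norm_integral_regKernelDzbar_sub_le (hα : 0 < α) (hα1 : α < 1) (hg : Continuous g)
    (hgc : HasCompactSupport g) (hH : 0 ≤ H) (hgH : ∀ x y, ‖g x - g y‖ ≤ H * ‖x - y‖ ^ α)
    {ε : ℝ} (hε : 0 < ε) (z : ℂ) :
    ‖(∫ ζ, regKernelDzbar ε (z - ζ) • g ζ) - (Real.pi : ℂ) • g z‖ ≤
      H * (radialMoment (α - 2) * ε ^ α) := by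
  have hk : Integrable (regKernelDzbar ε) := by
    refine integrable_of_le_norm_inv_div (C := ε ^ 2 * ε⁻¹) hε
      (continuous_regKernelDzbar hε) fun ξ hξ => ?_
    rw [norm_regKernelDzbar]
    have h0 : 0 < ‖ξ‖ := norm_pos_iff.2 hξ
    calc ε ^ 2 * ((‖ξ‖ ^ 2 + ε ^ 2)⁻¹) ^ 2
        = ε ^ 2 * ((‖ξ‖ ^ 2 + ε ^ 2)⁻¹ * (‖ξ‖ ^ 2 + ε ^ 2)⁻¹) := by ring
      _ ≤ ε ^ 2 * (ε⁻¹ * ‖ξ‖⁻¹ * (‖ξ‖ ^ 2 + ε ^ 2)⁻¹) := by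
          gcongr; exact inv_sq_add_sq_le h0 hε
      _ = _ := by ring
  have hκ := (integrable_norm_rpow_div (s := α - 2) (by linarith) (by linarith) hε).const_mul
    (ε ^ 2)
  have key := norm_integral_kernel_sub_le hk (integral_regKernelDzbar hε) hκ (α := α)
    (fun ξ => ?_) hg hgc hH hgH z
  · rw [integral_const_mul, integral_norm_rpow_div _ hε] at key
    refine key.trans (le_of_eq ?_)
    rw [Real.rpow_sub hε, Real.rpow_two, radialMoment]
    field_simp
  · rw [norm_regKernelDzbar]
    rcases (norm_nonneg ξ).eq_or_lt with h0 | h0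
    · rw [← h0, Real.zero_rpow hα.ne', mul_zero]; positivity
    · calc _ = ε ^ 2 * ((‖ξ‖ ^ 2 * (‖ξ‖ ^ 2 + ε ^ 2)⁻¹) * (‖ξ‖ ^ (α - 2) *
            (‖ξ‖ ^ 2 + ε ^ 2)⁻¹)) := by
            rw [Real.rpow_sub h0, Real.rpow_two]; field_simp
        _ ≤ ε ^ 2 * (1 * (‖ξ‖ ^ (α - 2) * (‖ξ‖ ^ 2 + ε ^ 2)⁻¹)) := by
            gcongr; exact sq_mul_inv_le_one hε
        _ = _ := by rw [one_mul, div_eq_mul_inv]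

/-- The second derivatives of the regularized transforms blow up no faster than `ε ^ (α - 1)`,
because their kernels are odd. -/
theorem norm_integral_fderiv_regKernelDz_le (hα : 0 < α) (hα1 : α < 1) (hg : Continuous g)
    (hgc : HasCompactSupport g) (hH : 0 ≤ H) (hgH : ∀ x y, ‖g x - g y‖ ≤ H * ‖x - y‖ ^ α)
    {ε : ℝ} (hε : 0 < ε) (z v : ℂ) :
    ‖∫ ζ, fderiv ℝ (regKernelDz ε) (z - ζ) v • g ζ‖ ≤
      H * (6 * radialMoment (α - 1) * ε ^ (α - 1)) * ‖v‖ := by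
  have hk : Integrable (fun ξ => fderiv ℝ (regKernelDz ε) ξ v) := by
    refine integrable_of_le_norm_inv_div (C := 6 * ‖v‖) hε
      (((contDiff_regKernelDz hε).continuous_fderiv one_ne_zero).clm_apply continuous_const)
      fun ξ hξ => (norm_fderiv_regKernelDz_le hε ξ v).trans ?_
    have h0 : 0 < ‖ξ‖ := norm_pos_iff.2 hξ
    calc 6 * ‖v‖ * (‖ξ‖ * ((‖ξ‖ ^ 2 + ε ^ 2)⁻¹) ^ 2)
        = 6 * ‖v‖ * (‖ξ‖⁻¹ * (‖ξ‖ ^ 2 * (‖ξ‖ ^ 2 + ε ^ 2)⁻¹) * (‖ξ‖ ^ 2 + ε ^ 2)⁻¹) := by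
          field_simp
      _ ≤ 6 * ‖v‖ * (‖ξ‖⁻¹ * 1 * (‖ξ‖ ^ 2 + ε ^ 2)⁻¹) := by
          gcongr; exact sq_mul_inv_le_one hε
      _ = _ := by ring
  have hm : ∫ ξ, fderiv ℝ (regKernelDz ε) ξ v = 0 :=
    integral_eq_zero_of_odd fun ξ => fderiv_regKernelDz_neg hε ξ v
  have hκ := (integrable_norm_rpow_div (s := α - 1) (by linarith) (by linarith) hε).const_mul
    (6 * ‖v‖)
  have key := norm_integral_kernel_sub_le hk hm hκ (α := α) (fun ξ => ?_) hg hgc hH hgH z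
  · rw [integral_const_mul, integral_norm_rpow_div _ hε, zero_smul, sub_zero] at key
    refine key.trans (le_of_eq ?_)
    rw [radialMoment]
    ring
  · rcases (norm_nonneg ξ).eq_or_lt with h0 | h0
    · rw [← h0, Real.zero_rpow hα.ne', mul_zero]; positivity
    · calc _ ≤ 6 * ‖v‖ * (‖ξ‖ * ((‖ξ‖ ^ 2 + ε ^ 2)⁻¹) ^ 2) * ‖ξ‖ ^ α := by
            gcongr; exact norm_fderiv_regKernelDz_le hε ξ v
        _ = 6 * ‖v‖ * ((‖ξ‖ ^ 2 * (‖ξ‖ ^ 2 + ε ^ 2)⁻¹) * (‖ξ‖ ^ (α - 1) *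
            (‖ξ‖ ^ 2 + ε ^ 2)⁻¹)) := by
            rw [Real.rpow_sub h0, Real.rpow_one]; field_simp
        _ ≤ 6 * ‖v‖ * (1 * (‖ξ‖ ^ (α - 1) * (‖ξ‖ ^ 2 + ε ^ 2)⁻¹)) := by
            gcongr; exact sq_mul_inv_le_one hε
        _ = _ := by rw [one_mul, div_eq_mul_inv]

end KernelAverages

section CauchyTransform

open MeasureTheory Filter Topology ComplexConjugate

variable {E : Type*} [NormedAddCommGroup E] [NormedSpace ℂ E]

/-- The real linear map `v ↦ v p + conj v q`, whose Wirtinger components are `p` and `q`. -/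
noncomputable def wirtinger (p q : E) : ℂ →L[ℝ] E :=
  (ContinuousLinearMap.id ℝ ℂ).smulRight p +
    (Complex.conjCLE : ℂ →L[ℝ] ℂ).smulRight q

@[simp]
theorem wirtinger_apply (p q : E) (v : ℂ) : wirtinger p q v = v • p + conj v • q := rfl

theorem norm_wirtinger_le (p q : E) : ‖wirtinger p q‖ ≤ ‖p‖ + ‖q‖ := by
  refine ContinuousLinearMap.opNorm_le_bound _ (by positivity) fun v => ?_
  rw [wirtinger_apply]
  refine (norm_add_le _ _).trans (le_of_eq ?_)
  rw [norm_smul, norm_smul, RCLike.norm_conj]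
  ring

theorem wirtinger_sub (p q p' q' : E) :
    wirtinger p q - wirtinger p' q' = wirtinger (p - p') (q - q') := by
  ext1 v
  simp only [sub_apply, wirtinger_apply, smul_sub]
  abel

theorem integrable_norm_inv_sub {X : Type*} [NormedAddCommGroup X] {g : ℂ → X}
    (hg : Continuous g)
    (hgc : HasCompactSupport g) (z : ℂ) : Integrable (fun ζ => ‖z - ζ‖⁻¹ * ‖g ζ‖) := by
  obtain ⟨B, hB⟩ := hgc.exists_bound_of_continuous hg
  have h1 := ((integrable_norm_rpow_div (s := -1) (ε := 1) (by norm_num) (by norm_num)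
    one_pos).comp_sub_left z).const_mul (2 * B)
  have h2 := (hg.norm.integrable_of_hasCompactSupport (μ := volume) hgc.norm)
  refine (h1.add h2).mono' (by fun_prop) (Eventually.of_forall fun ζ => ?_)
  rw [norm_mul, norm_inv, norm_norm, norm_norm, Pi.add_apply, Real.rpow_neg_one]
  have hB0 : 0 ≤ B := (norm_nonneg _).trans (hB 0)
  set r := ‖z - ζ‖
  have hr : 0 ≤ r := norm_nonneg _
  rcases le_total r 1 with h | h
  · have h3 : r⁻¹ * ‖g ζ‖ ≤ 2 * B * (r⁻¹ / (r ^ 2 + 1 ^ 2)) := by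
      have h4 : 1 ≤ 2 / (r ^ 2 + 1 ^ 2) := by
        rw [one_le_div (by positivity)]; nlinarith
      calc r⁻¹ * ‖g ζ‖ ≤ r⁻¹ * B * 1 := by
            rw [mul_one]; gcongr; exact hB ζ
        _ ≤ r⁻¹ * B * (2 / (r ^ 2 + 1 ^ 2)) := by gcongr
        _ = _ := by ring
    linarith [norm_nonneg (g ζ)]
  · have h3 : r⁻¹ * ‖g ζ‖ ≤ ‖g ζ‖ :=
      mul_le_of_le_one_left (norm_nonneg _) (inv_le_one_of_one_le₀ h)
    have : 0 ≤ 2 * B * (r⁻¹ / (r ^ 2 + 1 ^ 2)) := by positivity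
    linarith

/-- The potential `∫ |z - ζ|⁻¹` of a set of finite measure is small when the measure is: the two
terms bound the contributions of `|z - ζ| ≤ ρ` and of `|z - ζ| ≥ ρ`. -/
theorem integral_norm_inv_sub_le {X : Type*} [NormedAddCommGroup X] {g : ℂ → X}
    {K : Set ℂ} (hK : MeasurableSet K)
    (hKf : volume K ≠ ⊤) {N : ℝ} (hN : 0 ≤ N) (hgN : ∀ x, ‖g x‖ ≤ N)
    (hgK : ∀ x, x ∉ K → g x = 0) {ρ : ℝ} (hρ : 0 < ρ) (z : ℂ) :
    ∫ ζ, ‖z - ζ‖⁻¹ * ‖g ζ‖ ≤ N * (2 * radialMoment (-1) * ρ + volume.real K / ρ) := by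
  have i1 := ((integrable_norm_rpow_div (s := -1) (ε := ρ) (by norm_num) (by norm_num)
    hρ).comp_sub_left z).const_mul (2 * ρ ^ 2 * N)
  have i2 : Integrable (K.indicator fun _ => ρ⁻¹ * N) :=
    (integrable_indicator_iff hK).2 (integrableOn_const hKf)
  have hle : ∀ ζ, ‖z - ζ‖⁻¹ * ‖g ζ‖ ≤
      2 * ρ ^ 2 * N * (‖z - ζ‖ ^ (-1 : ℝ) / (‖z - ζ‖ ^ 2 + ρ ^ 2))
        + K.indicator (fun _ => ρ⁻¹ * N) ζ := by
    intro ζ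
    rw [Real.rpow_neg_one]
    set r := ‖z - ζ‖
    have hr : 0 ≤ r := norm_nonneg _
    by_cases hζ : ζ ∈ K
    · rw [indicator_of_mem hζ]
      rcases le_total r ρ with h | h
      · have h4 : 1 ≤ 2 * ρ ^ 2 / (r ^ 2 + ρ ^ 2) := by
          rw [one_le_div (by positivity)]; nlinarith
        have h3 : r⁻¹ * ‖g ζ‖ ≤ 2 * ρ ^ 2 * N * (r⁻¹ / (r ^ 2 + ρ ^ 2)) := by
          calc r⁻¹ * ‖g ζ‖ ≤ r⁻¹ * N * 1 := by
                rw [mul_one]; gcongr; exact hgN ζ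
            _ ≤ r⁻¹ * N * (2 * ρ ^ 2 / (r ^ 2 + ρ ^ 2)) := by gcongr
            _ = _ := by ring
        have : 0 ≤ ρ⁻¹ * N := by positivity
        linarith
      · have h3 : r⁻¹ * ‖g ζ‖ ≤ ρ⁻¹ * N := by gcongr; exact hgN ζ
        have : 0 ≤ 2 * ρ ^ 2 * N * (r⁻¹ / (r ^ 2 + ρ ^ 2)) := by positivity
        linarith
    · rw [hgK ζ hζ, indicator_of_notMem hζ, norm_zero, mul_zero, add_zero]
      positivity
  calc ∫ ζ, ‖z - ζ‖⁻¹ * ‖g ζ‖ ≤ ∫ ζ, (2 * ρ ^ 2 * N * (‖z - ζ‖ ^ (-1 : ℝ) / (‖z - ζ‖ ^ 2 + ρ ^ 2))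
        + K.indicator (fun _ => ρ⁻¹ * N) ζ) :=
        integral_mono_of_nonneg (Eventually.of_forall fun ζ => by positivity) (i1.add i2)
          (Eventually.of_forall hle)
    _ = _ := by
        rw [integral_add i1 i2, integral_const_mul, integral_sub_left_eq_self
          (fun ξ : ℂ => ‖ξ‖ ^ (-1 : ℝ) / (‖ξ‖ ^ 2 + ρ ^ 2)), integral_norm_rpow_div _ hρ,
          integral_indicator_const _ hK, Real.rpow_neg_one, radialMoment, smul_eq_mul]
        field_simp

/-- The Cauchy transform of `g`: a solution `w` of the inhomogeneous Cauchy-Riemann equation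
`w_x + i w_y = g`. -/
noncomputable def cauchyTransform (g : ℂ → E) (z : ℂ) : E :=
  (2 * Real.pi)⁻¹ • ∫ ζ, (z - ζ)⁻¹ • g ζ

theorem integrable_inv_sub_smul {g : ℂ → E} (hg : Continuous g)
    (hgc : HasCompactSupport g) (z : ℂ) : Integrable (fun ζ => (z - ζ)⁻¹ • g ζ) := by
  refine (integrable_norm_inv_sub hg hgc z).mono' ?_ (Eventually.of_forall fun ζ => ?_)
  · exact (Measurable.aestronglyMeasurable (by fun_prop)).smul hg.aestronglyMeasurable
  · rw [norm_smul, norm_inv]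

theorem cauchyTransform_sub {g h : ℂ → E} (hg : Continuous g) (hgc : HasCompactSupport g)
    (hh : Continuous h) (hhc : HasCompactSupport h) (z : ℂ) :
    cauchyTransform (fun x => g x - h x) z = cauchyTransform g z - cauchyTransform h z := by
  simp only [cauchyTransform, smul_sub]
  rw [integral_sub (integrable_inv_sub_smul hg hgc z) (integrable_inv_sub_smul hh hhc z), smul_sub]

theorem tendsto_integral_regKernel {g : ℂ → E} (hg : Continuous g)
    (hgc : HasCompactSupport g) {e : ℕ → ℝ} (he0 : ∀ n, 0 < e n) (he : Tendsto e atTop (𝓝 0))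
    (z : ℂ) :
    Tendsto (fun n => ∫ ζ, regKernel (e n) (z - ζ) • g ζ) atTop (𝓝 (∫ ζ, (z - ζ)⁻¹ • g ζ)) := by
  refine tendsto_integral_of_dominated_convergence (fun ζ => ‖z - ζ‖⁻¹ * ‖g ζ‖) (fun n => ?_)
    (integrable_norm_inv_sub hg hgc z) (fun n => Eventually.of_forall fun ζ => ?_) ?_
  · exact (((contDiff_regKernel (he0 n)).continuous.comp (by fun_prop)).smul
      hg).aestronglyMeasurable
  · rw [norm_smul]; gcongr; exact norm_regKernel_le _ _
  · have h0 : ∀ᵐ ζ : ℂ, ζ ≠ z := by simp [ae_iff]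
    filter_upwards [h0] with ζ hζ
    refine Tendsto.smul_const ?_ _
    have hz : z - ζ ≠ 0 := sub_ne_zero.2 hζ.symm
    generalize z - ζ = ξ at hz
    have hz' : ξ * conj ξ ≠ 0 := mul_ne_zero hz (by simpa using hz)
    have h1 : Tendsto (fun n => conj ξ * (ξ * conj ξ + ((e n : ℝ) : ℂ) ^ 2)⁻¹) atTop
        (𝓝 (conj ξ * (ξ * conj ξ + ((0 : ℝ) : ℂ) ^ 2)⁻¹)) := by
      refine Tendsto.const_mul _ (Tendsto.inv₀ (Tendsto.const_add _ ?_) ?_)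
      · exact ((Complex.continuous_ofReal.tendsto 0).comp he).pow 2
      · simpa using hz'
    have h2 : conj ξ * (ξ * conj ξ + ((0 : ℝ) : ℂ) ^ 2)⁻¹ = ξ⁻¹ := by
      have h3 : conj ξ ≠ 0 := right_ne_zero_of_mul hz'
      rw [Complex.ofReal_zero, zero_pow two_ne_zero, add_zero]
      field_simp
    rwa [h2] at h1

/-- The function `A`, a constant multiple of the Beurling transform of `g`, is the uniform limit of
the `z`-derivatives of the regularized transforms. -/
theorem exists_hasFDerivAt_integral_inv_sub [CompleteSpace E] {g : ℂ → E} {α H : ℝ}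
    (hα : 0 < α) (hα1 : α < 1) (hg : Continuous g) (hgc : HasCompactSupport g) (hH : 0 ≤ H)
    (hgH : ∀ x y, ‖g x - g y‖ ≤ H * ‖x - y‖ ^ α) :
    ∃ A : ℂ → E,
      (∀ z, HasFDerivAt (fun z => ∫ ζ, (z - ζ)⁻¹ • g ζ) (wirtinger (A z) ((Real.pi : ℂ) • g z)) z) ∧
      ∀ ε, 0 < ε → ∀ z, ‖(∫ ζ, regKernelDz ε (z - ζ) • g ζ) - A z‖ ≤
        H * (2 * radialMoment (α - 2) * ε ^ α) := by
  let e : ℕ → ℝ := fun n => 1 / ((n : ℝ) + 1)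
  have he0 : ∀ n, 0 < e n := fun n => Nat.one_div_pos_of_nat
  have he : Tendsto e atTop (𝓝 0) := tendsto_one_div_add_atTop_nhds_zero_nat
  have heanti : ∀ {m n}, m ≤ n → e n ≤ e m := fun h => Nat.one_div_le_one_div h
  have hbound : Tendsto (fun n => H * (2 * radialMoment (α - 2) * e n ^ α)) atTop (𝓝 0) := by
    have h := he.rpow_const (p := α) (Or.inr hα.le)
    rw [Real.zero_rpow hα.ne'] at h
    simpa using (h.const_mul (2 * radialMoment (α - 2))).const_mul H
  have hsub := fun {ε ε' : ℝ} (h0 : 0 < ε') (h : ε' ≤ ε) (z : ℂ) =>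
    norm_integral_regKernelDz_sub_le hα hα1 hg hgc hH hgH h0 h z
  have hlim : ∀ z, ∃ a, Tendsto (fun n => ∫ ζ, regKernelDz (e n) (z - ζ) • g ζ) atTop (𝓝 a) := by
    intro z
    refine cauchySeq_tendsto_of_complete (cauchySeq_of_le_tendsto_0' _ (fun n m hnm => ?_) hbound)
    rw [dist_eq_norm]
    exact hsub (he0 m) (heanti hnm) z
  choose A hA using hlim
  have hAε : ∀ ε, 0 < ε → ∀ z, ‖(∫ ζ, regKernelDz ε (z - ζ) • g ζ) - A z‖ ≤
      H * (2 * radialMoment (α - 2) * ε ^ α) := by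
    intro ε hε z
    refine le_of_tendsto ((hA z).const_sub _).norm ?_
    filter_upwards [he.eventually (gt_mem_nhds hε)] with n hn
    exact hsub (he0 n) hn.le z
  refine ⟨A, ?_, hAε⟩
  refine hasFDerivAt_of_tendstoUniformly (l := atTop)
    (f := fun n z => ∫ ζ, regKernel (e n) (z - ζ) • g ζ)
    (f' := fun n z => wirtinger (∫ ζ, regKernelDz (e n) (z - ζ) • g ζ)
      (∫ ζ, regKernelDzbar (e n) (z - ζ) • g ζ)) ?_ ?_
    (tendsto_integral_regKernel hg hgc he0 he)
  · rw [Metric.tendstoUniformly_iff]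
    intro η hη
    have hb2 : Tendsto (fun n => H * (2 * radialMoment (α - 2) * e n ^ α) +
        H * (radialMoment (α - 2) * e n ^ α)) atTop (𝓝 0) := by
      have := hbound.add (hbound.div_const 2)
      refine (by simpa using this : Tendsto _ _ _).congr fun n => ?_
      ring
    filter_upwards [hb2.eventually (gt_mem_nhds hη)] with n hn z
    rw [dist_comm, dist_eq_norm, wirtinger_sub]
    exact ((norm_wirtinger_le _ _).trans (add_le_add (hAε _ (he0 n) z)
      (norm_integral_regKernelDzbar_sub_le hα hα1 hg hgc hH hgH (he0 n) z))).trans_lt hn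
  · intro n z
    refine (hasFDerivAt_integral_kernel (contDiff_regKernel (he0 n)) hg hgc z).congr_fderiv ?_
    ext1 v
    rw [integral_kernel_fderiv_apply (contDiff_regKernel (he0 n)) hg hgc, wirtinger_apply,
      ← integral_smul, ← integral_smul, ← integral_add]
    · congr 1; ext ζ
      rw [fderiv_regKernel (he0 n), add_smul, mul_comm, mul_smul, mul_comm _ (conj v), mul_smul]
    · exact ((((contDiff_regKernelDz (he0 n)).continuous.comp (by fun_prop)).smul
        hg).integrable_of_hasCompactSupport hgc.smul_left).smul v
    · exact ((((continuous_regKernelDzbar (he0 n)).comp (by fun_prop)).smul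
        hg).integrable_of_hasCompactSupport hgc.smul_left).smul (conj v)

theorem norm_integral_regKernelDz_le {g : ℂ → E} {ε : ℝ} (hε : 0 < ε) (hg : Continuous g)
    (hgc : HasCompactSupport g) (z : ℂ) :
    ‖∫ ζ, regKernelDz ε (z - ζ) • g ζ‖ ≤ ε⁻¹ * ∫ ζ, ‖z - ζ‖⁻¹ * ‖g ζ‖ := by
  rw [← integral_const_mul]
  refine norm_integral_le_of_norm_le ((integrable_norm_inv_sub hg hgc z).const_mul _)
    (Eventually.of_forall fun ζ => ?_)
  rw [norm_smul, ← mul_assoc]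
  gcongr
  exact norm_regKernelDz_le hε _

theorem norm_integral_regKernelDz_lipschitz [CompleteSpace E] {g : ℂ → E} {α H : ℝ}
    (hα : 0 < α) (hα1 : α < 1) (hg : Continuous g) (hgc : HasCompactSupport g) (hH : 0 ≤ H)
    (hgH : ∀ x y, ‖g x - g y‖ ≤ H * ‖x - y‖ ^ α) {ε : ℝ} (hε : 0 < ε) (x y : ℂ) :
    ‖(∫ ζ, regKernelDz ε (x - ζ) • g ζ) - ∫ ζ, regKernelDz ε (y - ζ) • g ζ‖ ≤
      H * (6 * radialMoment (α - 1) * ε ^ (α - 1)) * ‖x - y‖ := by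
  have h := fun z => hasFDerivAt_integral_kernel (contDiff_regKernelDz hε) hg hgc z
  have h0 := radialMoment_nonneg (α - 1)
  refine convex_univ.norm_image_sub_le_of_norm_hasFDerivWithin_le
    (fun z _ => (h z).hasFDerivWithinAt) (fun z _ => ?_) (mem_univ y) (mem_univ x)
  refine ContinuousLinearMap.opNorm_le_bound _ (by positivity) fun v => ?_
  rw [integral_kernel_fderiv_apply (contDiff_regKernelDz hε) hg hgc]
  exact norm_integral_fderiv_regKernelDz_le hα hα1 hg hgc hH hgH hε z v

/-- The Cauchy transform solves the Cauchy-Riemann equation and gains one derivative on Hölder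
spaces. The bound `q` on the potential of `|g| / N` is small when `g` lives on a set of small
measure. -/
theorem exists_cauchyTransform_bound (E : Type*) [NormedAddCommGroup E] [NormedSpace ℂ E]
    [CompleteSpace E] {α : ℝ} (hα : 0 < α) (hα1 : α < 1) :
    ∃ C : ℝ, 1 ≤ C ∧ ∀ (δ N q : ℝ) (g : ℂ → E), 0 < δ → 0 ≤ N → 0 ≤ q →
      HolderBound α δ univ N g → HasCompactSupport g →
      (∀ z, ∫ ζ, ‖z - ζ‖⁻¹ * ‖g ζ‖ ≤ N * q) →
      Differentiable ℝ (cauchyTransform g) ∧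
      (∀ z, fderiv ℝ (cauchyTransform g) z 1 + Complex.I • fderiv ℝ (cauchyTransform g) z Complex.I
        = g z) ∧
      (∀ z, ‖cauchyTransform g z‖ ≤ q * N) ∧
      (∀ z, ‖fderiv ℝ (cauchyTransform g) z‖ ≤ C * N * (1 + q / δ)) ∧
      ∀ x y, ‖fderiv ℝ (cauchyTransform g) x - fderiv ℝ (cauchyTransform g) y‖ ≤
        C * N * (‖x - y‖ / δ) ^ α := by
  have hm2 := radialMoment_nonneg (α - 2)
  have hm1 := radialMoment_nonneg (α - 1)
  have hpi := Real.pi_pos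
  have hpi3 := Real.pi_gt_three
  refine ⟨4 * radialMoment (α - 2) + 6 * radialMoment (α - 1) + Real.pi, by linarith, ?_⟩
  intro δ N q g hδ hN hq hgB hgc hpot
  have hg : Continuous g := hgB.continuous hα
  set H : ℝ := N * (δ ^ α)⁻¹ with hHdef
  have hH : 0 ≤ H := by positivity
  have hHδ : ∀ {d : ℝ}, 0 ≤ d → N * (d / δ) ^ α = H * d ^ α := fun hd => by
    rw [Real.div_rpow hd hδ.le, hHdef]; ring
  have hgH : ∀ x y, ‖g x - g y‖ ≤ H * ‖x - y‖ ^ α := fun x y => by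
    rw [← hHδ (norm_nonneg _)]; exact hgB.2 x trivial y trivial
  obtain ⟨A, hA, hAε⟩ := exists_hasFDerivAt_integral_inv_sub hα hα1 hg hgc hH hgH
  have hw : ∀ z, HasFDerivAt (cauchyTransform g)
      ((2 * Real.pi)⁻¹ • wirtinger (A z) ((Real.pi : ℂ) • g z)) z := fun z =>
    (hA z).const_smul (2 * Real.pi)⁻¹
  have hc : (2 * Real.pi)⁻¹ ≤ 1 := inv_le_one_of_one_le₀ (by linarith)
  have hsmall : ∀ {X : Type _} [NormedAddCommGroup X] [NormedSpace ℝ X] (x : X),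
      ‖(2 * Real.pi)⁻¹ • x‖ ≤ ‖x‖ := fun x => by
    rw [norm_smul, Real.norm_of_nonneg (by positivity)]
    exact mul_le_of_le_one_left (norm_nonneg _) hc
  have hpin : ∀ x : E, ‖(Real.pi : ℂ) • x‖ = Real.pi * ‖x‖ := fun x => by
    rw [norm_smul, Complex.norm_real, Real.norm_of_nonneg hpi.le]
  refine ⟨fun z => (hw z).differentiableAt, fun z => ?_, fun z => ?_, fun z => ?_, fun x y => ?_⟩
  · rw [(hw z).fderiv]
    simp only [smul_apply, wirtinger_apply, map_one, one_smul, Complex.conj_I]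
    rw [smul_comm Complex.I, ← smul_add, smul_add Complex.I, smul_smul, smul_smul, mul_neg,
      Complex.I_mul_I, neg_neg, neg_smul, one_smul, one_smul]
    have e3 : A z + (Real.pi : ℂ) • g z + (-A z + (Real.pi : ℂ) • g z)
        = (2 * Real.pi : ℝ) • g z := by
      rw [← Complex.coe_smul]
      push_cast
      module
    rw [e3, inv_smul_smul₀ (by positivity)]
  · refine (hsmall _).trans ((norm_integral_le_of_norm_le (integrable_norm_inv_sub hg hgc z)
      (Eventually.of_forall fun ζ => ?_)).trans ((hpot z).trans (le_of_eq (mul_comm _ _))))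
    rw [norm_smul, norm_inv]
  · rw [(hw z).fderiv]
    refine (hsmall _).trans ((norm_wirtinger_le _ _).trans ?_)
    have h1 : ‖A z‖ ≤ 2 * radialMoment (α - 2) * N + N * (q / δ) := by
      have h2 := hAε δ hδ z
      have h3 := norm_integral_regKernelDz_le hδ hg hgc z
      have h4 : H * (2 * radialMoment (α - 2) * δ ^ α) = 2 * radialMoment (α - 2) * N := by
        rw [hHdef]
        have : δ ^ α ≠ 0 := (Real.rpow_pos_of_pos hδ _).ne'
        field_simp
      have h5 : δ⁻¹ * ∫ ζ, ‖z - ζ‖⁻¹ * ‖g ζ‖ ≤ N * (q / δ) := by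
        calc _ ≤ δ⁻¹ * (N * q) := by gcongr; exact hpot z
          _ = _ := by ring
      have h6 := norm_sub_norm_le (A z) (∫ ζ, regKernelDz δ (z - ζ) • g ζ)
      rw [norm_sub_rev] at h6
      linarith
    have h2 : ‖(Real.pi : ℂ) • g z‖ ≤ Real.pi * N := by
      rw [hpin]; gcongr; exact hgB.1 z trivial
    have h3 : 0 ≤ N * (q / δ) := by positivity
    have h4 : 0 ≤ N * radialMoment (α - 2) := by positivity
    have h5 : 0 ≤ N * radialMoment (α - 1) := by positivity
    have h6 : 0 ≤ N * (q / δ) * radialMoment (α - 2) := by positivity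
    have h7 : 0 ≤ N * (q / δ) * radialMoment (α - 1) := by positivity
    have h8 : N * (q / δ) ≤ N * (q / δ) * Real.pi := by nlinarith
    nlinarith
  · rw [(hw x).fderiv, (hw y).fderiv, ← smul_sub, wirtinger_sub, ← smul_sub]
    refine (hsmall _).trans ((norm_wirtinger_le _ _).trans ?_)
    rw [hpin]
    rcases eq_or_ne x y with rfl | hxy
    · simp; positivity
    set d := ‖x - y‖ with hd
    have hd0 : 0 < d := norm_pos_iff.2 (sub_ne_zero.2 hxy)
    rw [mul_assoc _ N, hHδ hd0.le]
    -- At distance `d`, `A` is compared with its regularization at the scale `d`.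
    have h1 := hAε d hd0 x
    have h2 := hAε d hd0 y
    have h3 := norm_integral_regKernelDz_lipschitz hα hα1 hg hgc hH hgH hd0 x y
    rw [← hd, Real.rpow_sub hd0, Real.rpow_one] at h3
    have h4 : H * (6 * radialMoment (α - 1) * (d ^ α / d)) * d =
        H * (6 * radialMoment (α - 1) * d ^ α) := by field_simp
    rw [h4] at h3
    have h5 : ‖A x - A y‖ ≤ H * (2 * radialMoment (α - 2) * d ^ α) +
        H * (6 * radialMoment (α - 1) * d ^ α) + H * (2 * radialMoment (α - 2) * d ^ α) := by
      set B := ∫ ζ, regKernelDz d (x - ζ) • g ζ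
      set B' := ∫ ζ, regKernelDz d (y - ζ) • g ζ
      have e : A x - A y = -(B - A x) + (B - B') + (B' - A y) := by abel
      rw [e]
      refine (norm_add_le _ _).trans (add_le_add ((norm_add_le _ _).trans (add_le_add ?_ h3)) h2)
      rw [norm_neg]; exact h1
    have h6 : Real.pi * ‖g x - g y‖ ≤ Real.pi * (H * d ^ α) := by
      gcongr; exact hgH x y
    linarith

end CauchyTransform

/-! ### Solving the equation in a thin neighbourhood -/

section FixedPoint

open MeasureTheory Filter Topology

variable {E : Type*} [NormedAddCommGroup E]

theorem HolderBound.of_tendsto {α δ N : ℝ} {S : Set ℂ} {f : ℕ → ℂ → E} {g : ℂ → E}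
    (hf : ∀ k, HolderBound α δ S N (f k)) (hg : ∀ x, Tendsto (fun k => f k x) atTop (𝓝 (g x))) :
    HolderBound α δ S N g :=
  ⟨fun x hx => le_of_tendsto' (hg x).norm fun k => (hf k).1 x hx,
    fun x hx y hy => le_of_tendsto' ((hg x).sub (hg y)).norm fun k => (hf k).2 x hx y hy⟩

/-- Banach's fixed point theorem on a ball of the scaled Hölder space of functions vanishing
off `K`. -/
theorem exists_fixedPoint_of_holderBound [CompleteSpace E] {α δ N₀ : ℝ} (hδ : 0 < δ)
    (hN₀ : 0 ≤ N₀) {K : Set ℂ} {Φ : (ℂ → E) → ℂ → E} (hsupp : ∀ g, ∀ x ∉ K, Φ g x = 0)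
    (h0 : HolderBound α δ univ N₀ (Φ fun _ => 0))
    (hcontr : ∀ N g h, 0 ≤ N → HolderBound α δ univ (2 * N₀) g → HolderBound α δ univ (2 * N₀) h →
      (∀ x ∉ K, g x = 0) → (∀ x ∉ K, h x = 0) → HolderBound α δ univ N (fun x => g x - h x) →
      HolderBound α δ univ (N / 2) (fun x => Φ g x - Φ h x)) :
    ∃ g, HolderBound α δ univ (2 * N₀) g ∧ (∀ x ∉ K, g x = 0) ∧ Φ g = g := by
  let s : ℕ → ℂ → E := fun n => Φ^[n] fun _ => 0
  have hs : ∀ n, s (n + 1) = Φ (s n) := fun n => Function.iterate_succ_apply' Φ n _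
  have hs0 : ∀ n, ∀ x ∉ K, s n x = 0 := by
    intro n x hx
    cases n with
    | zero => rfl
    | succ n => rw [hs]; exact hsupp _ x hx
  have hstep : ∀ n, HolderBound α δ univ (N₀ * (2 - 2 * (1 / 2) ^ n)) (s n) ∧
      HolderBound α δ univ (N₀ * (1 / 2) ^ n) (fun x => s (n + 1) x - s n x) := by
    intro n
    induction n with
    | zero =>
      refine ⟨?_, ?_⟩
      · have e : s 0 = fun _ => 0 := rfl
        rw [e]
        simpa using HolderBound.zero (X := E) (α := α) (δ := δ) (S := univ) hδ le_rfl
      · simpa [s] using h0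
    | succ n ih =>
      have hb : ∀ m, N₀ * (2 - 2 * (1 / 2) ^ m) ≤ 2 * N₀ := fun m => by
        have : 0 ≤ N₀ * (1 / 2) ^ m := by positivity
        linarith
      have h1 : HolderBound α δ univ (N₀ * (2 - 2 * (1 / 2) ^ (n + 1))) (s (n + 1)) := by
        have h := ih.1.add ih.2
        simp only [add_sub_cancel] at h
        convert h using 1
        ring
      refine ⟨h1, ?_⟩
      have h2 := hcontr _ _ _ (by positivity) (h1.mono hδ (hb _)) (ih.1.mono hδ (hb _)) (hs0 _)
        (hs0 _) ih.2
      rw [← hs, ← hs] at h2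
      convert h2 using 1
      ring
  have hlim : ∀ x, ∃ a, Tendsto (fun n => s n x) atTop (𝓝 a) := fun x =>
    cauchySeq_tendsto_of_complete <| cauchySeq_of_le_geometric (1 / 2) N₀ (by norm_num) fun n => by
      rw [dist_eq_norm, norm_sub_rev]; exact (hstep n).2.1 x trivial
  choose g hg using hlim
  have htail : ∀ n, HolderBound α δ univ (2 * N₀ * (1 / 2) ^ n) (fun x => g x - s n x) := by
    intro n
    have hk : ∀ k, HolderBound α δ univ (N₀ * (1 / 2) ^ n * (2 - 2 * (1 / 2) ^ k))
        (fun x => s (k + n) x - s n x) := by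
      intro k
      induction k with
      | zero => simpa using HolderBound.zero (X := E) (α := α) (δ := δ) (S := univ) hδ le_rfl
      | succ k ih =>
        have h := (hstep (k + n)).2.add ih
        simp only [sub_add_sub_cancel] at h
        rw [show k + 1 + n = k + n + 1 by ring]
        convert h using 1
        rw [pow_add]
        ring
    refine HolderBound.of_tendsto (fun k => (hk k).mono hδ ?_)
      (fun x => (((tendsto_add_atTop_iff_nat n).2 (hg x)).sub_const _))
    have : 0 ≤ N₀ * (1 / 2) ^ n * (1 / 2) ^ k := by positivity
    linarith
  have hgB : HolderBound α δ univ (2 * N₀) g := by simpa [s] using htail 0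
  have hgK : ∀ x ∉ K, g x = 0 := fun x hx =>
    tendsto_nhds_unique (hg x) (tendsto_const_nhds.congr fun n => (hs0 n x hx).symm)
  refine ⟨g, hgB, hgK, ?_⟩
  funext x
  refine tendsto_nhds_unique (f := fun n => s (n + 1) x) (l := atTop) ?_
    ((tendsto_add_atTop_iff_nat 1).2 (hg x))
  rw [tendsto_iff_norm_sub_tendsto_zero]
  have hz : Tendsto (fun n : ℕ => 2 * N₀ * (1 / 2 : ℝ) ^ n / 2) atTop (𝓝 0) := by
    simpa using ((tendsto_pow_atTop_nhds_zero_of_lt_one (r := (1 / 2 : ℝ)) (by norm_num)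
      (by norm_num)).const_mul (2 * N₀)).div_const 2
  refine squeeze_zero (fun _ => norm_nonneg _) (fun n => ?_) hz
  rw [norm_sub_rev, hs]
  refine (hcontr _ _ _ (by positivity) hgB ((hstep n).1.mono hδ ?_) hgK (hs0 n) (htail n)).1
    x trivial
  have : 0 ≤ N₀ * (1 / 2) ^ n := by positivity
  linarith

/-- The cut-off equal to `1` at distance at most `δ` from `Γ` and to `0` at distance at least
`2δ`. -/
noncomputable def tubeCutoff (Γ : Set ℂ) (δ : ℝ) (ζ : ℂ) : ℝ :=
  max 0 (min 1 (2 - Metric.infDist ζ Γ / δ))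

variable {Γ : Set ℂ} {δ : ℝ}

theorem tubeCutoff_nonneg (ζ : ℂ) : 0 ≤ tubeCutoff Γ δ ζ := le_max_left _ _

theorem tubeCutoff_le_one (ζ : ℂ) : tubeCutoff Γ δ ζ ≤ 1 :=
  max_le zero_le_one (min_le_left _ _)

theorem tubeCutoff_eq_one (hδ : 0 < δ) {ζ : ℂ} (h : Metric.infDist ζ Γ ≤ δ) :
    tubeCutoff Γ δ ζ = 1 := by
  have : Metric.infDist ζ Γ / δ ≤ 1 := (div_le_one hδ).2 h
  rw [tubeCutoff, min_eq_left (by linarith), max_eq_right zero_le_one]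

theorem tubeCutoff_eq_zero (hδ : 0 < δ) {ζ : ℂ} (h : 2 * δ ≤ Metric.infDist ζ Γ) :
    tubeCutoff Γ δ ζ = 0 := by
  have : 2 ≤ Metric.infDist ζ Γ / δ := (le_div_iff₀ hδ).2 h
  rw [tubeCutoff, max_eq_left ((min_le_right _ _).trans (by linarith))]

theorem abs_tubeCutoff_sub_le (hδ : 0 < δ) (x y : ℂ) :
    |tubeCutoff Γ δ x - tubeCutoff Γ δ y| ≤ 1 / δ * ‖x - y‖ := by
  rw [tubeCutoff, tubeCutoff, max_comm 0, max_comm 0]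
  refine (abs_max_sub_max_le_abs _ _ (0 : ℝ)).trans ?_
  have h1 : |min 1 (2 - Metric.infDist x Γ / δ) - min 1 (2 - Metric.infDist y Γ / δ)| ≤
      |(2 - Metric.infDist x Γ / δ) - (2 - Metric.infDist y Γ / δ)| := by
    have := abs_min_sub_min_le_max 1 (2 - Metric.infDist x Γ / δ) 1 (2 - Metric.infDist y Γ / δ)
    simpa using this
  refine h1.trans ?_
  have h2 := (Metric.lipschitz_infDist_pt Γ).dist_le_mul y x
  rw [Real.dist_eq, dist_eq_norm, NNReal.coe_one, one_mul, norm_sub_rev] at h2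
  rw [sub_sub_sub_cancel_left, ← sub_div, abs_div, abs_of_pos hδ, one_div, inv_mul_eq_div]
  gcongr

theorem holderBound_tubeCutoff {α : ℝ} (hα : 0 ≤ α) (hα1 : α ≤ 1) (hδ : 0 < δ) :
    HolderBound α δ univ 2 (tubeCutoff Γ δ) := by
  have h := HolderBound.of_lipschitz (f := tubeCutoff Γ δ) (S := univ) (N := 1) hα hα1 hδ
    zero_le_one (fun x _ => ?_) (fun x _ y _ => abs_tubeCutoff_sub_le hδ x y)
  · simpa using h
  · rw [Real.norm_of_nonneg (tubeCutoff_nonneg x)]; exact tubeCutoff_le_one x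

/-- Cut off at distance `δ`, a Lipschitz function vanishing on `Γ` is of size `O(δ)` in the Hölder
norm of scale `δ`. -/
theorem holderBound_tubeCutoff_smul [NormedSpace ℝ E] {α C : ℝ} (hα : 0 ≤ α) (hα1 : α ≤ 1)
    (hδ : 0 < δ) (hΓ : IsCompact Γ) (hΓ0 : Γ.Nonempty) {f : ℂ → E}
    (hf : ∀ x y, ‖f x - f y‖ ≤ C * ‖x - y‖) (hfΓ : ∀ x ∈ Γ, f x = 0) (hC : 0 ≤ C) :
    HolderBound α δ univ (6 * C * δ) (fun x => tubeCutoff Γ δ x • f x) := by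
  have hfd : ∀ x, ‖f x‖ ≤ C * Metric.infDist x Γ := fun x => by
    obtain ⟨y, hy, hxy⟩ := hΓ.exists_infDist_eq_dist hΓ0 x
    have := hf x y
    rwa [hfΓ y hy, sub_zero, ← dist_eq_norm, ← hxy] at this
  have hnear : ∀ x, Metric.infDist x Γ ≤ 2 * δ → ‖f x‖ ≤ 2 * C * δ := fun x hx =>
    (hfd x).trans (by nlinarith)
  have hlip : ∀ x y, Metric.infDist x Γ ≤ 2 * δ →
      ‖tubeCutoff Γ δ x • f x - tubeCutoff Γ δ y • f y‖ ≤ 3 * C * ‖x - y‖ := fun x y hx => by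
    have e : tubeCutoff Γ δ x • f x - tubeCutoff Γ δ y • f y =
        tubeCutoff Γ δ y • (f x - f y) + (tubeCutoff Γ δ x - tubeCutoff Γ δ y) • f x := by
      module
    rw [e]
    refine (norm_add_le _ _).trans ?_
    rw [norm_smul, norm_smul, Real.norm_of_nonneg (tubeCutoff_nonneg y)]
    have h1 : tubeCutoff Γ δ y * ‖f x - f y‖ ≤ 1 * (C * ‖x - y‖) := by
      gcongr
      · exact tubeCutoff_le_one y
      · exact hf x y
    have h2 : ‖tubeCutoff Γ δ x - tubeCutoff Γ δ y‖ * ‖f x‖ ≤ 1 / δ * ‖x - y‖ * (2 * C * δ) := by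
      gcongr
      · exact abs_tubeCutoff_sub_le hδ x y
      · exact hnear x hx
    have h3 : 1 / δ * ‖x - y‖ * (2 * C * δ) = 2 * C * ‖x - y‖ := by field_simp
    linarith
  have key := HolderBound.of_lipschitz (f := fun x => tubeCutoff Γ δ x • f x) (S := univ)
    (N := 3 * C * δ) hα hα1 hδ (by positivity) (fun x _ => ?_) (fun x _ y _ => ?_)
  · convert key using 1; ring
  · rcases le_total (Metric.infDist x Γ) (2 * δ) with h | h
    · rw [norm_smul, Real.norm_of_nonneg (tubeCutoff_nonneg x)]
      have : tubeCutoff Γ δ x * ‖f x‖ ≤ 1 * (2 * C * δ) := by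
        gcongr
        · exact tubeCutoff_le_one x
        · exact hnear x h
      have : 0 ≤ C * δ := by positivity
      linarith
    · rw [tubeCutoff_eq_zero hδ h, zero_smul, norm_zero]; positivity
  · rw [mul_div_cancel_right₀ _ hδ.ne']
    rcases le_total (Metric.infDist x Γ) (2 * δ) with h | h
    · exact hlip x y h
    · rcases le_total (Metric.infDist y Γ) (2 * δ) with h' | h'
      · rw [norm_sub_rev, norm_sub_rev x]; exact hlip y x h'
      · rw [tubeCutoff_eq_zero hδ h, tubeCutoff_eq_zero hδ h', zero_smul, zero_smul, sub_zero,
          norm_zero]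
        positivity

/-- The potential of thin neighbourhoods of a null compact set tends to zero. -/
theorem eventually_potential_le (hΓ : IsCompact Γ) (hΓ0 : volume Γ = 0) {t : ℝ} (ht : 0 < t) :
    ∃ ρ : ℝ, 0 < ρ ∧ ∀ᶠ δ in 𝓝[>] (0 : ℝ),
      2 * radialMoment (-1) * ρ + volume.real (Metric.cthickening (2 * δ) Γ) / ρ ≤ t := by
  have hc := radialMoment_nonneg (-1)
  set ρ := t / (4 * (radialMoment (-1) + 1)) with hρ
  have hρ0 : 0 < ρ := by positivity
  have h1 : 2 * radialMoment (-1) * ρ ≤ t / 2 := by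
    rw [hρ, mul_div_assoc', div_le_iff₀ (by positivity)]
    nlinarith
  refine ⟨ρ, hρ0, ?_⟩
  have h2 : Tendsto (fun δ : ℝ => volume (Metric.cthickening (2 * δ) Γ)) (𝓝 0) (𝓝 0) := by
    have h := tendsto_measure_cthickening_of_isCompact (μ := volume) hΓ
    rw [hΓ0] at h
    refine h.comp ?_
    have : Tendsto (fun δ : ℝ => 2 * δ) (𝓝 0) (𝓝 (2 * 0)) := tendsto_id.const_mul 2
    simpa using this
  have h3 := (ENNReal.tendsto_toReal (by simp : (0 : ℝ≥0∞) ≠ ⊤)).comp h2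
  have h4 : ∀ᶠ δ in 𝓝 (0 : ℝ), (volume (Metric.cthickening (2 * δ) Γ)).toReal < t / 2 * ρ :=
    h3.eventually (gt_mem_nhds (by simp; positivity))
  filter_upwards [h4.filter_mono nhdsWithin_le_nhds] with δ hδ
  have h5 : volume.real (Metric.cthickening (2 * δ) Γ) / ρ ≤ t / 2 :=
    (div_le_iff₀ hρ0).2 hδ.le
  linarith

end FixedPoint

section Solve

open MeasureTheory Filter Topology

variable {E : Type*} [NormedAddCommGroup E] [NormedSpace ℂ E] [CompleteSpace E]

/-- The nonlinear operator of the fixed point problem: a fixed point `g` yields the solution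
`cauchyTransform g`. -/
noncomputable def solveMap (Γ : Set ℂ) (δ : ℝ) (A : ℂ × E → (ℂ →L[ℝ] E) →L[ℝ] E) (R : ℂ × E → E)
    (g : ℂ → E) (x : ℂ) : E :=
  tubeCutoff Γ δ x • (A (x, cauchyTransform g x) (fderiv ℝ (cauchyTransform g) x)
    + R (x, cauchyTransform g x))

set_option maxSynthPendingDepth 3 in
set_option maxHeartbeats 800000 in
/-- A quasilinear perturbation of the inhomogeneous Cauchy-Riemann equation, whose data vanish at
`0` along a compact null set `Γ`, has arbitrarily small `C^{1,α}` solutions near `Γ`. -/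
theorem exists_small_solution {Γ : Set ℂ} (hΓ : IsCompact Γ) (hΓne : Γ.Nonempty)
    (hΓ0 : volume Γ = 0) {α : ℝ} (hα : 0 < α) (hα1 : α < 1)
    {A : ℂ × E → (ℂ →L[ℝ] E) →L[ℝ] E} {R : ℂ × E → E} {C₀ : ℝ} (hC₀ : 1 ≤ C₀)
    (hA : Differentiable ℝ A) (hA1 : ∀ x, ‖fderiv ℝ A x‖ ≤ C₀)
    (hA2 : ∀ x y, ‖fderiv ℝ A x - fderiv ℝ A y‖ ≤ C₀ * ‖x - y‖)
    (hR : Differentiable ℝ R) (hR1 : ∀ x, ‖fderiv ℝ R x‖ ≤ C₀)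
    (hR2 : ∀ x y, ‖fderiv ℝ R x - fderiv ℝ R y‖ ≤ C₀ * ‖x - y‖)
    (hA0 : ∀ ζ, A (ζ, 0) = 0) (hR0 : ∀ ζ ∈ Γ, R (ζ, 0) = 0) {κ : ℝ} (hκ : 0 < κ) :
    ∃ (δ : ℝ) (w : ℂ → E), 0 < δ ∧ ContDiff ℝ 1 w ∧
      (∀ ζ, Metric.infDist ζ Γ ≤ δ → fderiv ℝ w ζ 1 + Complex.I • fderiv ℝ w ζ Complex.I =
        A (ζ, w ζ) (fderiv ℝ w ζ) + R (ζ, w ζ)) ∧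
      (∀ ζ, ‖w ζ‖ ≤ κ) ∧ HolderBound α 1 univ κ (fderiv ℝ w) := by
  obtain ⟨C, hC, hT⟩ := exists_cauchyTransform_bound E hα hα1
  have hC0 : 0 < C := by linarith
  have hCC : 0 < C * C₀ := by positivity
  have hCC1 : 1 ≤ C * C₀ := one_le_mul_of_one_le_of_one_le hC hC₀
  -- `t` bounds both the scale `δ` and the potential `q` of the `2δ`-neighbourhood
  set t : ℝ := min (1 / (400 * (C * C₀))) (κ / (24 * (C * C₀))) with ht
  have ht0 : 0 < t := by positivity
  have ht1 : t * (400 * (C * C₀)) ≤ 1 := by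
    have := min_le_left (1 / (400 * (C * C₀))) (κ / (24 * (C * C₀)))
    rwa [← ht, le_div_iff₀ (by positivity)] at this
  have ht2 : t * (24 * (C * C₀)) ≤ κ := by
    have := min_le_right (1 / (400 * (C * C₀))) (κ / (24 * (C * C₀)))
    rwa [← ht, le_div_iff₀ (by positivity)] at this
  obtain ⟨ρ, hρ, hρδ⟩ := eventually_potential_le hΓ hΓ0 ht0
  have hpow : ∀ᶠ δ in 𝓝[>] (0 : ℝ), δ ^ (1 - α) ≤ t := by
    have h1 : Tendsto (fun δ : ℝ => δ ^ (1 - α)) (𝓝 0) (𝓝 (0 ^ (1 - α))) :=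
      (Real.continuousAt_rpow_const 0 (1 - α) (Or.inr (by linarith)))
    rw [Real.zero_rpow (by linarith)] at h1
    exact ((h1.eventually (gt_mem_nhds ht0)).filter_mono nhdsWithin_le_nhds).mono fun _ h => h.le
  have hδt : ∀ᶠ δ in 𝓝[>] (0 : ℝ), δ < t := (gt_mem_nhds ht0).filter_mono nhdsWithin_le_nhds
  obtain ⟨δ, ⟨⟨hq, hδpow⟩, hδt⟩, hδ⟩ := ((hρδ.and hpow).and hδt).and self_mem_nhdsWithin |>.exists
  replace hδ : 0 < δ := hδ
  have ht3 : t ≤ 1 / 400 := by nlinarith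
  have hδ1 : δ ≤ 1 := by linarith
  set μ : ℝ := δ + t with hμ
  have hμ0 : 0 < μ := by positivity
  have hμ1 : C * C₀ * μ ≤ 1 / 200 := by nlinarith
  have hμ2 : 12 * (C * C₀) * μ ≤ κ := by nlinarith
  set K : Set ℂ := Metric.cthickening (2 * δ) Γ with hK
  have hKc : IsCompact K := hΓ.cthickening
  have hKd : ∀ x ∉ K, 2 * δ ≤ Metric.infDist x Γ := fun x hx => by
    by_contra! h
    obtain ⟨y, hy, hxy⟩ := (Metric.infDist_lt_iff hΓne).1 h
    exact hx (Metric.mem_cthickening_of_dist_le x y _ _ hy hxy.le)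
  -- estimates for the Cauchy transform in scaled form
  have hTw : ∀ (N : ℝ) (g : ℂ → E), 0 ≤ N → HolderBound α δ univ N g → (∀ x ∉ K, g x = 0) →
      Differentiable ℝ (cauchyTransform g) ∧
      (∀ z, fderiv ℝ (cauchyTransform g) z 1 + Complex.I • fderiv ℝ (cauchyTransform g) z Complex.I
        = g z) ∧
      (∀ z, ‖cauchyTransform g z‖ ≤ C * μ * N) ∧
      (∀ z, ‖fderiv ℝ (cauchyTransform g) z‖ ≤ C * μ * N / δ) ∧
      (∀ x y, ‖fderiv ℝ (cauchyTransform g) x - fderiv ℝ (cauchyTransform g) y‖ ≤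
        C * N * (‖x - y‖ / δ) ^ α) ∧
      HolderBound α δ univ (2 * (C * μ * N)) (cauchyTransform g) ∧
      HolderBound α δ univ (C * μ * N / δ) (fderiv ℝ (cauchyTransform g)) := by
    intro N g hN hg hgK
    obtain ⟨h1, h2, h3, h4, h5⟩ := hT δ N t g hδ hN ht0.le hg (HasCompactSupport.intro hKc hgK)
      fun z => by
        refine (integral_norm_inv_sub_le hKc.measurableSet hKc.measure_lt_top.ne hN
          (fun x => hg.1 x trivial) hgK hρ z).trans ?_
        gcongr
    have e : C * N * (1 + t / δ) = C * μ * N / δ := by rw [hμ]; field_simp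
    have h3' : ∀ z, ‖cauchyTransform g z‖ ≤ C * μ * N := fun z => (h3 z).trans (by
      have : 0 ≤ t * N := by positivity
      have : 0 ≤ C * δ * N := by positivity
      rw [hμ]; nlinarith)
    have h4' : ∀ z, ‖fderiv ℝ (cauchyTransform g) z‖ ≤ C * μ * N / δ := fun z => by
      rw [← e]; exact h4 z
    refine ⟨h1, h2, h3', h4', h5, HolderBound.of_lipschitz hα.le hα1.le hδ (by positivity)
      (fun z _ => h3' z) (fun x _ y _ => ?_), fun z _ => h4' z, fun x _ y _ => (h5 x y).trans ?_⟩
    · exact convex_univ.norm_image_sub_le_of_norm_fderiv_le (𝕜 := ℝ) (fun z _ => h1 z)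
        (fun z _ => h4' z) (mem_univ y) (mem_univ x)
    · have : C * N ≤ C * μ * N / δ := by
        rw [← e]
        exact le_mul_of_one_le_right (by positivity) (by have : 0 ≤ t / δ := by positivity
                                                         linarith)
      gcongr
  have hTsub : ∀ (N₁ N₂ : ℝ) (g h : ℂ → E), HolderBound α δ univ N₁ g → HolderBound α δ univ N₂ h →
      (∀ x ∉ K, g x = 0) → (∀ x ∉ K, h x = 0) →
      cauchyTransform (fun x => g x - h x) = fun x => cauchyTransform g x - cauchyTransform h x :=
    fun N₁ N₂ g h hg hh hgK hhK => funext fun z =>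
      cauchyTransform_sub (hg.continuous hα) (HasCompactSupport.intro hKc hgK)
        (hh.continuous hα) (HasCompactSupport.intro hKc hhK) z
  have hT0 : cauchyTransform (fun _ => (0 : E)) = fun _ => 0 := by
    funext z; simp [cauchyTransform]
  have hχ := holderBound_tubeCutoff (Γ := Γ) hα.le hα1.le hδ
  obtain ⟨g, hg, hgK, hfix⟩ := exists_fixedPoint_of_holderBound (Φ := solveMap Γ δ A R)
      (N₀ := 6 * C₀ * δ) (α := α) (K := K) hδ (by positivity)
      (fun g x hx => by rw [solveMap, tubeCutoff_eq_zero hδ (hKd x hx), zero_smul])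
      (by
        have hl : ∀ x y : ℂ, ‖R (x, 0) - R (y, 0)‖ ≤ C₀ * ‖x - y‖ := fun x y => by
          have := convex_univ.norm_image_sub_le_of_norm_fderiv_le (𝕜 := ℝ) (fun z _ => hR z)
            (fun z _ => hR1 z) (mem_univ ((y, 0) : ℂ × E)) (mem_univ (x, 0))
          rwa [Prod.mk_sub_mk, sub_zero, Prod.norm_mk, norm_zero,
            max_eq_left (norm_nonneg _)] at this
        refine (holderBound_tubeCutoff_smul hα.le hα1.le hδ hΓ hΓne hl hR0 (by positivity)).congr
          fun x _ => ?_
        simp only [solveMap, hT0, hA0]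
        simp)
      (by
        intro N g h hN hg hh hgK hhK hgh
        obtain ⟨-, -, -, -, -, hwg, hDg⟩ := hTw _ g (by positivity) hg hgK
        obtain ⟨hdh, -, -, -, -, hwh, hDh⟩ := hTw _ h (by positivity) hh hhK
        obtain ⟨-, -, -, -, -, hwd, hDd⟩ := hTw N _ hN hgh fun x hx => by
          rw [hgK x hx, hhK x hx, sub_zero]
        have hdg := (hTw _ g (by positivity) hg hgK).1
        rw [hTsub _ _ g h hg hh hgK hhK] at hwd hDd
        replace hDd := hDd.congr (g := fun x => fderiv ℝ (cauchyTransform g) x -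
          fderiv ℝ (cauchyTransform h) x) fun x _ => (fderiv_fun_sub (hdg x) (hdh x)).symm
        set M : ℝ := 2 * (C * μ * (2 * (6 * C₀ * δ))) with hM
        set P : ℝ := C * μ * (2 * (6 * C₀ * δ)) / δ with hP
        have hPe : P = 12 * (C * C₀ * μ) := by rw [hP]; field_simp; ring
        have hMe : M = 24 * (C * C₀ * μ) * δ := by rw [hM]; ring
        have hM0 : 0 ≤ M := by positivity
        have hM1 : M ≤ 1 := by
          rw [hMe]
          have : 0 ≤ C * C₀ * μ := by positivity
          nlinarith
        have hAd := HolderBound.comp_sub hA hA1 hA2 hα.le hα1.le hδ hδ1 hM1 hwg hwh hwd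
        have hRd := HolderBound.comp_sub hR hR1 hR2 hα.le hα1.le hδ hδ1 hM1 hwg hwh hwd
        have hAh := HolderBound.comp_sub hA hA1 hA2 hα.le hα1.le hδ hδ1 hM1 hwh
          (HolderBound.zero hδ hM0) (by simpa using hwh)
        simp only [hA0, sub_zero] at hAh
        have hid := ContinuousLinearMap.norm_id_le (𝕜 := ℝ) (E := (ℂ →L[ℝ] E) →L[ℝ] E)
        have t1 := HolderBound.bilin (ContinuousLinearMap.id ℝ ((ℂ →L[ℝ] E) →L[ℝ] E)) hAd hDg
        have t2 := HolderBound.bilin (ContinuousLinearMap.id ℝ ((ℂ →L[ℝ] E) →L[ℝ] E)) hAh hDd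
        have t3 := HolderBound.bilin (ContinuousLinearMap.lsmul ℝ ℝ) hχ ((t1.add t2).add hRd)
        have hls := ContinuousLinearMap.opNorm_lsmul_le (𝕜 := ℝ) (R := ℝ) (E := E)
        -- The difference is split as `(A_g - A_h) dw_g + A_h (dw_g - dw_h) + (R_g - R_h)`.
        refine (t3.congr fun x _ => ?_).mono hδ ?_
        · simp only [solveMap, ContinuousLinearMap.lsmul_apply, ContinuousLinearMap.id_apply,
            map_sub, sub_apply]
          rw [← smul_sub]
          congr 1
          abel
        · set n1 := ‖ContinuousLinearMap.id ℝ ((ℂ →L[ℝ] E) →L[ℝ] E)‖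
          set n2 := ‖(ContinuousLinearMap.lsmul ℝ ℝ : ℝ →L[ℝ] E →L[ℝ] E)‖
          have hs0 : 0 ≤ C * C₀ * μ := by positivity
          have b1 : 2 * n1 * (5 * C₀ * (2 * (C * μ * N))) * P ≤ 2 * 1 *
              (5 * C₀ * (2 * (C * μ * N))) * P := by gcongr
          have b2 : 2 * n1 * (5 * C₀ * M) * (C * μ * N / δ) ≤
              2 * 1 * (5 * C₀ * M) * (C * μ * N / δ) := by gcongr
          have c1 : 2 * 1 * (5 * C₀ * (2 * (C * μ * N))) * P = 240 * (C * C₀ * μ) ^ 2 * N := by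
            rw [hPe]; ring
          have c2 : 2 * 1 * (5 * C₀ * M) * (C * μ * N / δ) = 240 * (C * C₀ * μ) ^ 2 * N := by
            rw [hMe]; field_simp; ring
          have c3 : 5 * C₀ * (2 * (C * μ * N)) = 10 * (C * C₀ * μ) * N := by ring
          rw [c1] at b1
          rw [c2] at b2
          have hsum : 2 * n1 * (5 * C₀ * (2 * (C * μ * N))) * P +
              2 * n1 * (5 * C₀ * M) * (C * μ * N / δ) + 5 * C₀ * (2 * (C * μ * N)) ≤ N / 8 := by
            rw [c3] at b1 ⊢
            have d1 : (C * C₀ * μ) ^ 2 ≤ 1 / 200 * (1 / 200) := by rw [sq]; gcongr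
            have d2 : (C * C₀ * μ) ^ 2 * N ≤ 1 / 200 * (1 / 200) * N := by gcongr
            have d3 : C * C₀ * μ * N ≤ 1 / 200 * N := by gcongr
            linarith
          calc _ ≤ 2 * 1 * 2 * (N / 8) := by gcongr
            _ = N / 2 := by ring)
  obtain ⟨h1, h2, h3, h4, h5, -, -⟩ := hTw _ g (by positivity) hg hgK
  have e4 : C * μ * (2 * (6 * C₀ * δ)) / δ = 12 * (C * C₀) * μ := by field_simp; ring
  have hD : HolderBound α 1 univ κ (fderiv ℝ (cauchyTransform g)) := by
    refine ⟨fun z _ => (h4 z).trans (by rw [e4]; exact hμ2), fun x _ y _ => (h5 x y).trans ?_⟩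
    rw [div_one, Real.div_rpow (norm_nonneg _) hδ.le]
    have e5 : C * (2 * (6 * C₀ * δ)) * (‖x - y‖ ^ α / δ ^ α) =
        12 * (C * C₀) * δ ^ (1 - α) * ‖x - y‖ ^ α := by
      rw [Real.rpow_sub hδ, Real.rpow_one]; ring
    rw [e5]
    gcongr
    nlinarith
  refine ⟨δ, cauchyTransform g, hδ, ?_, fun ζ hζ => ?_, fun z => (h3 z).trans ?_, hD⟩
  · rw [contDiff_one_iff_fderiv]
    exact ⟨h1, hD.continuous hα⟩
  · rw [h2]
    conv_lhs => rw [← hfix]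
    rw [solveMap, tubeCutoff_eq_one hδ hζ, one_smul]
  · have : 0 ≤ 12 * (C * C₀) * μ := by positivity
    calc C * μ * (2 * (6 * C₀ * δ)) = 12 * (C * C₀) * μ * δ := by ring
      _ ≤ 12 * (C * C₀) * μ * 1 := by gcongr
      _ ≤ κ := by linarith

end Solve

/-! ### Extension and smoothing of curves -/

section Curves

open MeasureTheory Filter Topology

variable {F : Type*} [NormedAddCommGroup F] [NormedSpace ℝ F]

theorem hasDerivAt_integral_zero [CompleteSpace F] {G : ℝ → F} (hG : Continuous G) (t : ℝ) :
    HasDerivAt (fun t => ∫ s in (0 : ℝ)..t, G s) (G t) t :=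
  intervalIntegral.integral_hasDerivAt_right (hG.intervalIntegrable _ _)
    hG.aestronglyMeasurable.stronglyMeasurableAtFilter hG.continuousAt

theorem contDiff_succ_of_hasDerivAt {k : ℕ} {f G : ℝ → F} (hf : ∀ t, HasDerivAt f (G t) t)
    (hG : ContDiff ℝ k G) : ContDiff ℝ (k + 1 : ℕ) f := by
  push_cast
  rw [contDiff_succ_iff_deriv]
  refine ⟨fun t => (hf t).differentiableAt, by simp, ?_⟩
  rwa [funext fun t => (hf t).deriv]

/-- A `C^k` curve on `[0, 1]` extends to a `C^k` curve on the line: extend the last derivative by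
constants and integrate. -/
theorem exists_contDiff_extension [CompleteSpace F] (k : ℕ) (f : ℝ → F)
    (hf : ContDiffOn ℝ k f (Icc 0 1)) :
    ∃ G : ℝ → F, ContDiff ℝ k G ∧ ∀ t ∈ Icc (0 : ℝ) 1, G t = f t := by
  induction k generalizing f with
  | zero =>
    refine ⟨IccExtend zero_le_one ((Icc (0 : ℝ) 1).domRestrict f), ?_, fun t ht => ?_⟩
    · simp only [Nat.cast_zero, contDiff_zero, contDiffOn_zero] at hf ⊢
      exact (continuousOn_iff_continuous_domRestrict.1 hf).Icc_extend'
    · rw [IccExtend_of_mem _ _ ht]; rfl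
  | succ k ih =>
    have hu : UniqueDiffOn ℝ (Icc (0 : ℝ) 1) := uniqueDiffOn_Icc one_pos
    push_cast at hf
    rw [contDiffOn_succ_iff_derivWithin hu] at hf
    obtain ⟨G, hG, hGf⟩ := ih _ hf.2.2
    have hd : ∀ t, HasDerivAt (fun t => f 0 + ∫ s in (0 : ℝ)..t, G s) (G t) t := fun t =>
      (hasDerivAt_integral_zero hG.continuous t).const_add _
    refine ⟨_, contDiff_succ_of_hasDerivAt hd hG, ?_⟩
    refine eq_of_derivWithin_eq (fun t _ => (hd t).differentiableAt.differentiableWithinAt) hf.1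
      (fun t ht => ?_) (by simp)
    have ht' := mem_Icc_of_Ico ht
    rw [(hd t).hasDerivWithinAt.derivWithin (hu t ht'), hGf t ht']

/-- Difference quotients of a `C¹` curve converge to its derivative uniformly on `[0, 1]`. -/
theorem eventually_slope_sub_deriv_le {f G : ℝ → F} (hf : ∀ t, HasDerivAt f (G t) t)
    (hG : Continuous G) {η : ℝ} (hη : 0 < η) :
    ∀ᶠ h in 𝓝[>] (0 : ℝ), ∀ t ∈ Icc (0 : ℝ) 1, ‖h⁻¹ • (f (t + h) - f t) - G t‖ ≤ η := by
  have huc := (isCompact_Icc (a := (0 : ℝ)) (b := 2)).uniformContinuousOn_of_continuous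
    hG.continuousOn
  obtain ⟨d, hd, hdη⟩ := Metric.uniformContinuousOn_iff.1 huc η hη
  have h1 : ∀ᶠ h in 𝓝[>] (0 : ℝ), h < min d 1 :=
    (gt_mem_nhds (by positivity)).filter_mono nhdsWithin_le_nhds
  filter_upwards [h1, self_mem_nhdsWithin] with h hh hh0 t ht
  replace hh0 : 0 < h := hh0
  have hhd := hh.trans_le (min_le_left _ _)
  have hh1 := hh.trans_le (min_le_right _ _)
  have key := (convex_Icc t (t + h)).norm_image_sub_le_of_norm_hasDerivWithin_le
    (f := fun s => f s - s • G t) (f' := fun s => G s - G t) (C := η) (x := t) (y := t + h)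
    (fun s _ => ((hf s).sub (by simpa using (hasDerivAt_id s).smul_const (G t))).hasDerivWithinAt)
    (fun s hs => ?_) (left_mem_Icc.2 (by linarith)) (right_mem_Icc.2 (by linarith))
  · have e : f (t + h) - (t + h) • G t - (f t - t • G t) =
        h • (h⁻¹ • (f (t + h) - f t) - G t) := by
      rw [smul_sub, smul_inv_smul₀ hh0.ne']; module
    rw [e, norm_smul, add_sub_cancel_left, mul_comm] at key
    exact le_of_mul_le_mul_right key (norm_pos_iff.2 hh0.ne')
  · rw [← dist_eq_norm]
    refine (hdη s ⟨by linarith [ht.1, hs.1], by linarith [ht.2, hs.2]⟩ t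
      ⟨ht.1, by linarith [ht.2]⟩ ?_).le
    rw [Real.dist_eq, abs_lt]
    constructor <;> linarith [hs.1, hs.2]

/-- Averaging over short intervals gains one derivative, and changes a curve little in `C²`. -/
theorem exists_contDiff_succ_near [CompleteSpace F] (k : ℕ) {f : ℝ → F}
    (hf : ContDiff ℝ (k + 2 : ℕ) f) {η : ℝ}
    (hη : 0 < η) : ∃ p : ℝ → F, ContDiff ℝ (k + 3 : ℕ) p ∧ ∀ t ∈ Icc (0 : ℝ) 1,
      ‖p t - f t‖ ≤ η ∧ ‖deriv p t - deriv f t‖ ≤ η ∧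
      ‖deriv (deriv p) t - deriv (deriv f) t‖ ≤ η := by
  have hf1 : ContDiff ℝ (k + 1 : ℕ) (deriv f) := by
    have h := hf
    rw [show ((k + 2 : ℕ) : WithTop ℕ∞) = (k + 1 : ℕ) + 1 by push_cast; ring,
      contDiff_succ_iff_deriv] at h
    exact h.2.2
  have hf2 : ContDiff ℝ k (deriv (deriv f)) := by
    have h := hf1
    push_cast at h
    rw [contDiff_succ_iff_deriv] at h
    exact h.2.2
  have hd0 := hasDerivAt_integral_zero hf.continuous
  have hd1 : ∀ t, HasDerivAt f (deriv f t) t := fun t =>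
    (hf.differentiable (by simp) t).hasDerivAt
  have hd2 : ∀ t, HasDerivAt (deriv f) (deriv (deriv f) t) t := fun t =>
    (hf1.differentiable (by simp) t).hasDerivAt
  obtain ⟨h, ⟨⟨⟨h0, h1⟩, h2⟩, -⟩⟩ := (((eventually_slope_sub_deriv_le hd0 hf.continuous hη).and
    (eventually_slope_sub_deriv_le hd1 hf1.continuous hη)).and
    (eventually_slope_sub_deriv_le hd2 hf2.continuous hη)).and self_mem_nhdsWithin |>.exists
  have hq : ∀ {a b : ℝ → F}, (∀ t, HasDerivAt a (b t) t) → ∀ t,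
      HasDerivAt (fun t => h⁻¹ • (a (t + h) - a t)) (h⁻¹ • (b (t + h) - b t)) t := fun hab t =>
    (((hab (t + h)).comp_add_const t h).sub (hab t)).const_smul h⁻¹
  have e1 : deriv (fun t => h⁻¹ • ((∫ s in (0 : ℝ)..(t + h), f s) - ∫ s in (0 : ℝ)..t, f s)) =
      fun t => h⁻¹ • (f (t + h) - f t) := funext fun t => (hq hd0 t).deriv
  refine ⟨fun t => h⁻¹ • ((∫ s in (0 : ℝ)..(t + h), f s) - ∫ s in (0 : ℝ)..t, f s),
    contDiff_succ_of_hasDerivAt (hq hd0) ?_, fun t ht => ⟨h0 t ht, ?_, ?_⟩⟩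
  · exact ((hf.comp (contDiff_id.add contDiff_const)).sub hf).const_smul _
  · rw [e1]; exact h1 t ht
  · rw [e1, (hq hd1 t).deriv]; exact h2 t ht

theorem exists_contDiff_four_near [CompleteSpace F] {f : ℝ → F} (hf : ContDiff ℝ 2 f) {η : ℝ}
    (hη : 0 < η) : ∃ p : ℝ → F, ContDiff ℝ 4 p ∧ ∀ t ∈ Icc (0 : ℝ) 1,
      ‖p t - f t‖ ≤ η ∧ ‖deriv p t - deriv f t‖ ≤ η ∧
      ‖deriv (deriv p) t - deriv (deriv f) t‖ ≤ η := by
  obtain ⟨p, hp, hpf⟩ := exists_contDiff_succ_near 0 hf (half_pos hη)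
  obtain ⟨q, hq, hqp⟩ := exists_contDiff_succ_near 1 hp (half_pos hη)
  refine ⟨q, hq, fun t ht => ?_⟩
  obtain ⟨a0, a1, a2⟩ := hpf t ht
  obtain ⟨b0, b1, b2⟩ := hqp t ht
  have tri : ∀ {a b c : F}, ‖b - c‖ ≤ η / 2 → ‖a - b‖ ≤ η / 2 → ‖a - c‖ ≤ η := fun h h' =>
    (norm_sub_le_norm_sub_add_norm_sub _ _ _).trans (by linarith)
  exact ⟨tri a0 b0, tri a1 b1, tri a2 b2⟩

end Curves

/-! ### Straightening the arc -/

section Straightening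

open MeasureTheory Filter Topology
open scoped Manifold

/-- A smooth bump function for a compact set in an open set of the plane. -/
theorem exists_bump {Γ W : Set ℂ} (hΓ : IsCompact Γ) (hW : IsOpen W) (hΓW : Γ ⊆ W) :
    ∃ χ : ℂ → ℝ, ContDiff ℝ 3 χ ∧ HasCompactSupport χ ∧ tsupport χ ⊆ W ∧ ∀ᶠ x in 𝓝ˢ Γ, χ x = 1 := by
  obtain ⟨T, hT, hΓT, hTW⟩ := exists_compact_between hΓ hW hΓW
  obtain ⟨χ, h1, h0, -⟩ := exists_contMDiffMap_one_nhds_of_subset_interior (n := 3) 𝓘(ℝ, ℂ)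
    hΓ.isClosed hΓT
  have hs : tsupport χ ⊆ T := closure_minimal (fun x hx => by
    by_contra h; exact hx (h0 x h)) hT.isClosed
  exact ⟨χ, χ.contMDiff.contDiff, HasCompactSupport.intro hT h0, hs.trans hTW, h1⟩

/-- Multiplication by a nonzero complex number as a real linear automorphism of the plane. -/
noncomputable def mulEquiv (c : ℂ) (hc : c ≠ 0) : ℂ ≃L[ℝ] ℂ :=
  ContinuousLinearEquiv.equivOfInverse (ContinuousLinearMap.mul ℝ ℂ c)
    (ContinuousLinearMap.mul ℝ ℂ c⁻¹)
    (fun x => by simp [← mul_assoc, inv_mul_cancel₀ hc])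
    (fun x => by simp [← mul_assoc, mul_inv_cancel₀ hc])

@[simp]
theorem mulEquiv_apply {c : ℂ} (hc : c ≠ 0) (v : ℂ) : mulEquiv c hc v = c * v := rfl

/-- The map `t + i s ↦ γ t + i s γ' t`, a local diffeomorphism near the parameter interval whose
differential there is complex linear. -/
noncomputable def tubeMap (γ : ℝ → ℂ) (z : ℂ) : ℂ := γ z.re + Complex.I * z.im * deriv γ z.re

theorem tubeMap_ofReal (γ : ℝ → ℂ) (t : ℝ) : tubeMap γ t = γ t := by simp [tubeMap]

theorem contDiff_tubeMap {γ : ℝ → ℂ} (hγ : ContDiff ℝ 4 γ) : ContDiff ℝ 3 (tubeMap γ) := by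
  have h1 : ContDiff ℝ 3 (deriv γ) := hγ.deriv'
  have hre : ContDiff ℝ 3 Complex.re := Complex.reCLM.contDiff
  have him : ContDiff ℝ 3 (fun z : ℂ => (z.im : ℂ)) :=
    Complex.ofRealCLM.contDiff.comp Complex.imCLM.contDiff
  exact ((hγ.of_le (by norm_num)).comp hre).add ((contDiff_const.mul him).mul (h1.comp hre))

theorem hasFDerivAt_tubeMap {γ : ℝ → ℂ} (hγ : ContDiff ℝ 4 γ) (t : ℝ) (ht : deriv γ t ≠ 0) :
    HasFDerivAt (tubeMap γ) (mulEquiv (deriv γ t) ht : ℂ →L[ℝ] ℂ) t := by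
  have h1 : Differentiable ℝ (deriv γ) :=
    (hγ.deriv' (n := 3)).differentiable (by norm_num)
  have hre : HasFDerivAt Complex.re Complex.reCLM (t : ℂ) := Complex.reCLM.hasFDerivAt
  have him : HasFDerivAt (fun z : ℂ => (z.im : ℂ)) (Complex.ofRealCLM.comp Complex.imCLM) (t : ℂ) :=
    (Complex.ofRealCLM.comp Complex.imCLM).hasFDerivAt
  have a1 : HasDerivAt γ (deriv γ t) (t : ℂ).re :=
    (hγ.differentiable (by norm_num) _).hasDerivAt
  have a2 : HasDerivAt (deriv γ) (deriv (deriv γ) t) (t : ℂ).re := (h1 _).hasDerivAt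
  have key := (a1.hasFDerivAt.comp (t : ℂ) hre).add
    ((him.const_mul Complex.I).mul (a2.hasFDerivAt.comp (t : ℂ) hre))
  refine key.congr_fderiv ?_
  ext v
  simp [mul_comm]
  linear_combination (deriv γ t) * Complex.re_add_im v

/-- Near the arc there are coordinates in which it becomes the interval `[0, 1]` and which are
complex differentiable along the arc. -/
theorem exists_straightening {γ : ℝ → ℂ} (hγ : IsSmoothArc γ) :
    ∃ Θ : ℂ → ℂ, ContDiff ℝ 3 Θ ∧ HasCompactSupport Θ ∧ volume (arc γ) = 0 ∧
      ∀ t ∈ Icc (0 : ℝ) 1, Θ (γ t) = t ∧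
        ∀ v, fderiv ℝ Θ (γ t) v = (derivWithin γ (Icc 0 1) t)⁻¹ * v := by
  obtain ⟨β, hβ, hβγ⟩ := exists_contDiff_extension 4 γ (contDiffOn_infty.1 hγ.smooth 4)
  replace hβ : ContDiff ℝ 4 β := hβ
  have hdβ : ∀ t ∈ Icc (0 : ℝ) 1, deriv β t = derivWithin γ (Icc 0 1) t := fun t ht => by
    rw [← derivWithin_congr (f := γ) (fun s hs => hβγ s hs) (hβγ t ht),
      (hβ.differentiable (by norm_num) t).derivWithin (uniqueDiffOn_Icc one_pos t ht)]
  have hd0 : ∀ t ∈ Icc (0 : ℝ) 1, deriv β t ≠ 0 := fun t ht => by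
    rw [hdβ t ht]; exact hγ.deriv_ne_zero t ht
  set Ψ := tubeMap β with hΨ
  have hΨC : ContDiff ℝ 3 Ψ := contDiff_tubeMap hβ
  set K : Set ℂ := (fun t : ℝ => (t : ℂ)) '' Icc 0 1 with hKdef
  have hK : IsCompact K := isCompact_Icc.image Complex.continuous_ofReal
  have hΨK : ∀ t ∈ Icc (0 : ℝ) 1, Ψ t = γ t := fun t ht => by
    rw [hΨ, tubeMap_ofReal, hβγ t ht]
  have harc : Ψ '' K = arc γ := by
    rw [hKdef, image_image, arc]
    exact image_congr hΨK
  have hstrict : ∀ t (ht : t ∈ Icc (0 : ℝ) 1), HasStrictFDerivAt Ψ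
      (mulEquiv (deriv β t) (hd0 t ht) : ℂ →L[ℝ] ℂ) t := fun t ht =>
    hΨC.contDiffAt.hasStrictFDerivAt' (hasFDerivAt_tubeMap hβ t (hd0 t ht)) (by norm_num)
  have hinj : InjOn Ψ K := by
    rintro _ ⟨s, hs, rfl⟩ _ ⟨t, ht, rfl⟩ h
    simp only [hΨK s hs, hΨK t ht] at h
    rw [hγ.injOn hs ht h]
  obtain ⟨V, hV, hVinj⟩ := hinj.exists_mem_nhdsSet hK (fun _ _ => hΨC.continuous.continuousAt)
    (by
      rintro _ ⟨t, ht, rfl⟩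
      refine ⟨_, ((hstrict t ht).toOpenPartialHomeomorph Ψ).open_source.mem_nhds
        (hstrict t ht).mem_toOpenPartialHomeomorph_source, ?_⟩
      exact ((hstrict t ht).toOpenPartialHomeomorph Ψ).injOn)
  have hleft : ∀ x ∈ V, Function.invFunOn Ψ V (Ψ x) = x := hVinj.leftInvOn_invFunOn
  set Θ₀ := Function.invFunOn Ψ V with hΘ₀
  have hVn : ∀ t ∈ Icc (0 : ℝ) 1, V ∈ 𝓝 (t : ℂ) := fun t ht =>
    mem_nhdsSet_iff_forall.1 hV _ ⟨t, ht, rfl⟩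
  have hloc : ∀ t (ht : t ∈ Icc (0 : ℝ) 1), ∀ᶠ y in 𝓝 (Ψ t),
      Θ₀ y = (hstrict t ht).localInverse Ψ _ _ y := fun t ht =>
    (hstrict t ht).localInverse_unique (by filter_upwards [hVn t ht] with x hx using hleft x hx)
  have hΘC : ∀ y ∈ arc γ, ContDiffAt ℝ 3 Θ₀ y := by
    rintro _ ⟨t, ht, rfl⟩
    rw [← hΨK t ht]
    refine ContDiffAt.congr_of_eventuallyEq ?_ (hloc t ht)
    exact hΨC.contDiffAt.to_localInverse (hasFDerivAt_tubeMap hβ t (hd0 t ht)) (by norm_num)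
  have hΘd : ∀ t (ht : t ∈ Icc (0 : ℝ) 1), HasFDerivAt Θ₀
      ((mulEquiv (deriv β t) (hd0 t ht)).symm : ℂ →L[ℝ] ℂ) (γ t) := fun t ht => by
    rw [← hΨK t ht]
    exact (hstrict t ht).to_localInverse.hasFDerivAt.congr_of_eventuallyEq (hloc t ht)
  have harcK : IsCompact (arc γ) := by
    rw [← harc]; exact hK.image hΨC.continuous
  obtain ⟨χ, hχ, hχc, hχs, hχ1⟩ := exists_bump (W := {y | ContDiffAt ℝ 3 Θ₀ y}) harcK
    (isOpen_iff_mem_nhds.2 fun y hy => ContDiffAt.eventually hy (by decide)) hΘC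
  have heq : ∀ t ∈ Icc (0 : ℝ) 1, (fun y => χ y • Θ₀ y) =ᶠ[𝓝 (γ t)] Θ₀ := fun t ht => by
    filter_upwards [(eventually_nhdsSet_iff_forall.1 hχ1) (γ t) ⟨t, ht, rfl⟩] with y hy
    rw [hy, one_smul]
  refine ⟨fun y => χ y • Θ₀ y, ?_, hχc.smul_right, ?_, fun t ht => ⟨?_, fun v => ?_⟩⟩
  · rw [contDiff_iff_contDiffAt]
    intro y
    by_cases hy : y ∈ tsupport χ
    · exact hχ.contDiffAt.smul (hχs hy)
    · refine contDiffAt_const (c := (0 : ℂ)) |>.congr_of_eventuallyEq ?_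
      filter_upwards [(isClosed_tsupport χ).isOpen_compl.mem_nhds hy] with z hz
      rw [image_eq_zero_of_notMem_tsupport hz, zero_smul]
  · rw [← harc]
    refine addHaar_image_eq_zero_of_differentiableOn_of_addHaar_eq_zero volume
      (hΨC.differentiable (by norm_num)).differentiableOn ?_
    refine measure_mono_null (t := (LinearMap.ker Complex.imLm : Set ℂ)) ?_ ?_
    · rintro _ ⟨t, -, rfl⟩
      simp
    · refine Measure.addHaar_submodule volume _ fun h => ?_
      have : Complex.I ∈ LinearMap.ker Complex.imLm := h ▸ Submodule.mem_top
      simp at this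
  · refine (heq t ht).eq_of_nhds.trans ?_
    rw [← hΨK t ht, hleft _ (mem_of_mem_nhds (hVn t ht))]
  · rw [(heq t ht).fderiv_eq, (hΘd t ht).fderiv, ← hdβ t ht]
    rfl

end Straightening

/-! ### Hölder norms along the arc -/

section ArcNorm

open MeasureTheory Filter Topology

theorem isCompact_arc {γ : ℝ → ℂ} (hγ : IsSmoothArc γ) : IsCompact (arc γ) :=
  isCompact_Icc.image_of_continuousOn hγ.smooth.continuousOn

theorem exists_lipschitz_of_hasCompactSupport {V X : Type*} [NormedAddCommGroup V] [NormedSpace ℝ V]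
    [NormedAddCommGroup X] [NormedSpace ℝ X] {f : V → X} (hf : ContDiff ℝ 1 f)
    (hc : HasCompactSupport f) : ∃ L : ℝ, 1 ≤ L ∧ ∀ x y, ‖f x - f y‖ ≤ L * ‖x - y‖ := by
  obtain ⟨B, hB⟩ := hc.fderiv (𝕜 := ℝ) |>.exists_bound_of_continuous
    (hf.continuous_fderiv one_ne_zero)
  refine ⟨max 1 B, le_max_left _ _, fun x y => ?_⟩
  exact convex_univ.norm_image_sub_le_of_norm_fderiv_le (𝕜 := ℝ)
    (fun z _ => hf.differentiable one_ne_zero z) (fun z _ => (hB z).trans (le_max_right _ _))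
    (mem_univ y) (mem_univ x)

theorem exists_fderiv_bounds_of_hasCompactSupport {V X : Type*} [NormedAddCommGroup V]
    [NormedSpace ℝ V] [NormedAddCommGroup X] [NormedSpace ℝ X] {f : V → X} (hf : ContDiff ℝ 2 f)
    (hc : HasCompactSupport f) : ∃ C : ℝ, 1 ≤ C ∧ (∀ x, ‖fderiv ℝ f x‖ ≤ C) ∧
      ∀ x y, ‖fderiv ℝ f x - fderiv ℝ f y‖ ≤ C * ‖x - y‖ := by
  have hf' : ContDiff ℝ 1 (fderiv ℝ f) := hf.fderiv_right (by norm_num)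
  obtain ⟨B, hB⟩ := (hc.fderiv (𝕜 := ℝ)).exists_bound_of_continuous hf'.continuous
  obtain ⟨L, hL, hLf⟩ := exists_lipschitz_of_hasCompactSupport hf' (hc.fderiv (𝕜 := ℝ))
  refine ⟨max L B, hL.trans (le_max_left _ _), fun x => (hB x).trans (le_max_right _ _),
    fun x y => (hLf x y).trans ?_⟩
  gcongr
  exact le_max_left _ _

theorem exists_holderBound_of_contDiff {X : Type*} [NormedAddCommGroup X] [NormedSpace ℝ X]
    {α : ℝ} (hα : 0 ≤ α) (hα1 : α ≤ 1) {Γ : Set ℂ} (hΓ : IsCompact Γ) {f : ℂ → X}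
    (hf : ContDiff ℝ 1 f) : ∃ N : ℝ, 0 < N ∧ HolderBound α 1 Γ N f := by
  obtain ⟨r, hr⟩ := hΓ.isBounded.subset_closedBall 0
  have hK := isCompact_closedBall (0 : ℂ) r
  obtain ⟨B, hB⟩ := hK.exists_bound_of_continuousOn hf.continuous.continuousOn
  obtain ⟨B', hB'⟩ := hK.exists_bound_of_continuousOn
    (hf.continuous_fderiv one_ne_zero).continuousOn
  refine ⟨2 * max 1 (max B B'), by positivity,
    HolderBound.of_lipschitz hα hα1 one_pos (by positivity)
    (fun x hx => (hB x (hr hx)).trans ((le_max_left _ _).trans (le_max_right _ _)))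
    fun x hx y hy => ?_⟩
  rw [div_one]
  exact (convex_closedBall (0 : ℂ) r).norm_image_sub_le_of_norm_fderiv_le (𝕜 := ℝ)
    (fun z _ => hf.differentiable one_ne_zero z)
    (fun z hz => (hB' z hz).trans ((le_max_right _ _).trans (le_max_right _ _))) (hr hy) (hr hx)

/-- Arc length is comparable to the chord, so the unit tangent of the arc is a Hölder function of
the point of the arc. -/
theorem exists_unitTangent_bound {γ : ℝ → ℂ} (hγ : IsSmoothArc γ) {α : ℝ} (hα : 0 ≤ α)
    (hα1 : α ≤ 1) : ∃ T : ℝ, 0 ≤ T ∧ ∀ s ∈ Icc (0 : ℝ) 1, ∀ t ∈ Icc (0 : ℝ) 1,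
      ‖‖derivWithin γ (Icc 0 1) s‖⁻¹ • derivWithin γ (Icc 0 1) s -
        ‖derivWithin γ (Icc 0 1) t‖⁻¹ • derivWithin γ (Icc 0 1) t‖ ≤ T * ‖γ s - γ t‖ ^ α := by
  obtain ⟨Θ, hΘ, hΘc, -, hΘγ⟩ := exists_straightening hγ
  obtain ⟨L, hL, hLΘ⟩ := exists_lipschitz_of_hasCompactSupport (hΘ.of_le (by norm_num)) hΘc
  have hu : UniqueDiffOn ℝ (Icc (0 : ℝ) 1) := uniqueDiffOn_Icc one_pos
  set τ : ℝ → ℂ := fun t => ‖derivWithin γ (Icc 0 1) t‖⁻¹ • derivWithin γ (Icc 0 1) t with hτ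
  have h1 : ContDiffOn ℝ 1 (derivWithin γ (Icc 0 1)) (Icc 0 1) :=
    (hγ.smooth.derivWithin hu (m := 1) (by norm_cast))
  have hτC : ContDiffOn ℝ 1 τ (Icc 0 1) :=
    ((h1.norm ℝ hγ.deriv_ne_zero).inv fun t ht =>
      norm_ne_zero_iff.2 (hγ.deriv_ne_zero t ht)).smul h1
  obtain ⟨B, hB⟩ := isCompact_Icc.exists_bound_of_continuousOn
    (hτC.continuousOn_derivWithin hu le_rfl)
  have hB0 : 0 ≤ B := (norm_nonneg _).trans (hB 0 (by simp))
  have hτ1 : ∀ t ∈ Icc (0 : ℝ) 1, ‖τ t‖ = 1 := fun t ht => by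
    rw [hτ, norm_smul, norm_inv, norm_norm, inv_mul_cancel₀ (norm_ne_zero_iff.2
      (hγ.deriv_ne_zero t ht))]
  have hlip : ∀ s ∈ Icc (0 : ℝ) 1, ∀ t ∈ Icc (0 : ℝ) 1, ‖τ s - τ t‖ ≤ B * L * ‖γ s - γ t‖ := by
    intro s hs t ht
    have h2 := (convex_Icc (0 : ℝ) 1).norm_image_sub_le_of_norm_derivWithin_le
      (hτC.differentiableOn one_ne_zero) hB ht hs
    have h3 := hLΘ (γ s) (γ t)
    rw [(hΘγ s hs).1, (hΘγ t ht).1, ← Complex.ofReal_sub, Complex.norm_real] at h3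
    calc _ ≤ B * ‖s - t‖ := h2
      _ ≤ B * (L * ‖γ s - γ t‖) := by gcongr
      _ = _ := by ring
  refine ⟨B * L + 2, by positivity, fun s hs t ht => ?_⟩
  change ‖τ s - τ t‖ ≤ _
  set d := ‖γ s - γ t‖
  rcases le_total d 1 with hd | hd
  · calc _ ≤ B * L * d := hlip s hs t ht
      _ ≤ (B * L + 2) * d ^ α := by
          gcongr
          · linarith
          · exact HolderBound.self_le_rpow hα1 (norm_nonneg _) hd
  · have h3 : 1 ≤ d ^ α := Real.one_le_rpow hd hα
    have h4 : 0 ≤ B * L := by positivity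
    calc _ ≤ ‖τ s‖ + ‖τ t‖ := norm_sub_le _ _
      _ = 2 := by rw [hτ1 s hs, hτ1 t ht]; norm_num
      _ ≤ (B * L + 2) * d ^ α := by nlinarith

/-- The `C^{1,α}` norm along the arc is controlled by a Hölder bound for the differential of an
extension to the plane. -/
theorem exists_c1HolderNorm_le {γ : ℝ → ℂ} (hγ : IsSmoothArc γ) {α : ℝ} (hα : 0 ≤ α)
    (hα1 : α ≤ 1) (n : ℕ) : ∃ C : ℝ, 0 < C ∧ ∀ (e : ℝ) (H f : ℂ → RealCn n), 0 ≤ e →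
      ContDiff ℝ 1 H → (∀ ζ ∈ arc γ, ‖H ζ‖ ≤ e) → HolderBound α 1 (arc γ) e (fderiv ℝ H) →
      (∀ t ∈ Icc (0 : ℝ) 1, f (γ t) = H (γ t)) →
      c1HolderNorm α γ f ≤ ENNReal.ofReal (C * e) := by
  obtain ⟨T, hT, hTγ⟩ := exists_unitTangent_bound hγ hα hα1
  refine ⟨3 + T, by positivity, fun e H f he hH h0 h1 hf => ?_⟩
  have hu : UniqueDiffOn ℝ (Icc (0 : ℝ) 1) := uniqueDiffOn_Icc one_pos
  have hγm : ∀ t ∈ Icc (0 : ℝ) 1, γ t ∈ arc γ := fun t ht => ⟨t, ht, rfl⟩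
  set τ : ℝ → ℂ := fun t => ‖derivWithin γ (Icc 0 1) t‖⁻¹ • derivWithin γ (Icc 0 1) t with hτ
  have hτ1 : ∀ t ∈ Icc (0 : ℝ) 1, ‖τ t‖ = 1 := fun t ht => by
    rw [hτ, norm_smul, norm_inv, norm_norm, inv_mul_cancel₀ (norm_ne_zero_iff.2
      (hγ.deriv_ne_zero t ht))]
  have heq : EqOn (f ∘ γ) (H ∘ γ) (Icc 0 1) := hf
  have hCk : IsCkOnArc 1 γ f := by
    have : ContDiffOn ℝ 1 (H ∘ γ) (Icc 0 1) :=
      hH.comp_contDiffOn (hγ.smooth.of_le (by norm_cast))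
    exact this.congr heq
  have hD : ∀ t ∈ Icc (0 : ℝ) 1, arcDeriv γ f t = fderiv ℝ H (γ t) (τ t) := fun t ht => by
    have hg := (hγ.smooth.differentiableOn (by simp) t ht).hasDerivWithinAt
    have hc := (hH.differentiable one_ne_zero (γ t)).hasFDerivAt.comp_hasDerivWithinAt t hg
    rw [arcDeriv, derivWithin_congr heq (heq ht), hc.derivWithin (hu t ht), hτ, map_smul]
  rw [c1HolderNorm, if_pos hCk]
  have hsplit : ENNReal.ofReal ((3 + T) * e) =
      ENNReal.ofReal e + ENNReal.ofReal e + ENNReal.ofReal ((1 + T) * e) := by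
    rw [← ENNReal.ofReal_add he he, ← ENNReal.ofReal_add (by positivity) (by positivity)]
    congr 1; ring
  rw [hsplit]
  refine add_le_add (add_le_add (iSup₂_le fun t ht => ?_) (iSup₂_le fun t ht => ?_))
    (iSup₂_le fun s hs => iSup₂_le fun t ht => iSup_le fun hst => ?_)
  · rw [hf t ht]
    exact ENNReal.ofReal_le_ofReal (h0 _ (hγm t ht))
  · refine ENNReal.ofReal_le_ofReal ?_
    rw [hD t ht]
    have := (fderiv ℝ H (γ t)).le_of_opNorm_le (h1.1 _ (hγm t ht)) (τ t)
    rwa [hτ1 t ht, mul_one] at this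
  · refine ENNReal.ofReal_le_ofReal ?_
    have hd : 0 < ‖γ s - γ t‖ := norm_pos_iff.2 (sub_ne_zero.2 fun h => hst (hγ.injOn hs ht h))
    rw [div_le_iff₀ (Real.rpow_pos_of_pos hd _), hD s hs, hD t ht]
    have e1 : fderiv ℝ H (γ s) (τ s) - fderiv ℝ H (γ t) (τ t) =
        (fderiv ℝ H (γ s) - fderiv ℝ H (γ t)) (τ s) + fderiv ℝ H (γ t) (τ s - τ t) := by
      simp
    rw [e1]
    have h2 := ContinuousLinearMap.le_of_opNorm_le _ (h1.2 _ (hγm s hs) _ (hγm t ht)) (τ s)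
    rw [hτ1 s hs, mul_one, div_one] at h2
    have h3 := ContinuousLinearMap.le_of_opNorm_le _ (h1.1 _ (hγm t ht)) (τ s - τ t)
    have h4 : e * ‖τ s - τ t‖ ≤ e * (T * ‖γ s - γ t‖ ^ α) := by
      gcongr; exact hTγ s hs t ht
    refine (norm_add_le _ _).trans ?_
    linarith

end ArcNorm

/-! ### Correction of an approximate solution -/

section Correction

variable {E : Type*} [NormedAddCommGroup E] [NormedSpace ℂ E]

/-- Twice the `∂̄`-derivative, as an operator on real differentials. -/
noncomputable def dbar (E : Type*) [NormedAddCommGroup E] [NormedSpace ℂ E] :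
    (ℂ →L[ℝ] E) →L[ℝ] E :=
  ContinuousLinearMap.apply ℝ E (1 : ℂ) +
    ((Complex.I • ContinuousLinearMap.id ℂ E).restrictScalars ℝ).comp
      (ContinuousLinearMap.apply ℝ E Complex.I)

theorem dbar_apply (Λ : ℂ →L[ℝ] E) : dbar E Λ = Λ 1 + Complex.I • Λ Complex.I := rfl

set_option maxSynthPendingDepth 3 in
/-- Suppose that `u₀` satisfies at the points of a null compact set `Γ` the equation conjugated by
`Q` to the standard Cauchy–Riemann equation. With `Q` evaluated along `u₀ + P w`, the equation for
the correction `w` is a quasilinear perturbation of the inhomogeneous Cauchy–Riemann equation,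
since `Q P` is the identity where `w = 0`; hence there are arbitrarily small `w` solving it near
`Γ`. -/
theorem exists_corrected_solution [FiniteDimensional ℝ E] {Γ : Set ℂ} (hΓ : IsCompact Γ)
    (hΓne : Γ.Nonempty) (hΓ0 : MeasureTheory.volume Γ = 0) {α : ℝ} (hα : 0 < α) (hα1 : α < 1)
    {P Q : E → E →L[ℝ] E} (hP : ContDiff ℝ 3 P) (hQ : ContDiff ℝ 3 Q)
    (hQP : ∀ z v, Q z (P z v) = v) {u₀ : ℂ → E} (hu₀ : ContDiff ℝ 3 u₀)
    (h0 : ∀ ζ ∈ Γ, dbar E ((Q (u₀ ζ)).comp (fderiv ℝ u₀ ζ)) = 0) {κ : ℝ} (hκ : 0 < κ)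
    (hκ1 : κ ≤ 1) :
    ∃ (U : Set ℂ) (w : ℂ → E), IsOpen U ∧ Γ ⊆ U ∧ ContDiff ℝ 1 w ∧
      (∀ ζ ∈ U, dbar E ((Q (u₀ ζ + P (u₀ ζ) (w ζ))).comp
        (fderiv ℝ (fun ζ => u₀ ζ + P (u₀ ζ) (w ζ)) ζ)) = 0) ∧
      (∀ ζ, ‖w ζ‖ ≤ κ) ∧ HolderBound α 1 univ κ (fderiv ℝ w) := by
  have : CompleteSpace E := FiniteDimensional.complete ℝ E
  set PP : ℂ → E →L[ℝ] E := fun ζ => P (u₀ ζ) with hPP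
  have hPPc : ContDiff ℝ 3 PP := hP.comp hu₀
  set M : ℂ × E → E →L[ℝ] E := fun x => Q (u₀ x.1 + PP x.1 x.2) with hM
  have hPP1 : ContDiff ℝ 3 fun x : ℂ × E => PP x.1 := hPPc.comp contDiff_fst
  have hMc : ContDiff ℝ 3 M :=
    hQ.comp ((hu₀.comp contDiff_fst).add (hPP1.clm_apply contDiff_snd))
  let b : (E →L[ℝ] E) →L[ℝ] (ℂ →L[ℝ] E) →L[ℝ] E :=
    (ContinuousLinearMap.compL ℝ (ℂ →L[ℝ] E) (ℂ →L[ℝ] E) E (dbar E)).comp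
      (ContinuousLinearMap.compL ℝ ℂ E E)
  -- The equation for `w` reads `w_x + i w_y = A₀ (·, w) (dw) + R₀ (·, w)`.
  set A₀ : ℂ × E → (ℂ →L[ℝ] E) →L[ℝ] E :=
    fun x => b (ContinuousLinearMap.id ℝ E - (M x).comp (PP x.1)) with hA₀
  have hA₀c : ContDiff ℝ 2 A₀ :=
    b.contDiff.comp (contDiff_const.sub
      ((hMc.clm_comp hPP1).of_le (show (2 : WithTop ℕ∞) ≤ 3 by norm_num)))
  set R₀ : ℂ × E → E := fun x =>
    -dbar E ((M x).comp (fderiv ℝ u₀ x.1 + (fderiv ℝ PP x.1).flip x.2)) with hR₀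
  have hR₀c : ContDiff ℝ 2 R₀ := by
    have d1 : ContDiff ℝ 2 fun x : ℂ × E => fderiv ℝ u₀ x.1 :=
      (hu₀.fderiv_right (by norm_num)).comp contDiff_fst
    have d2 : ContDiff ℝ 2 fun x : ℂ × E => (fderiv ℝ PP x.1).flip :=
      (ContinuousLinearMap.flipₗᵢ ℝ ℂ E E).contDiff.comp
        ((hPPc.fderiv_right (m := 2) (by norm_num)).comp contDiff_fst)
    exact ((dbar E).contDiff.comp ((hMc.of_le (by norm_num)).clm_comp
      (d1.add (d2.clm_apply contDiff_snd)))).neg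
  obtain ⟨r, hr1, hr⟩ : ∃ r : ℝ, 1 ≤ r ∧ Γ ⊆ Metric.ball 0 r := by
    obtain ⟨r, hr⟩ := hΓ.isBounded.subset_ball (0 : ℂ)
    exact ⟨max 1 r, le_max_left _ _, hr.trans (Metric.ball_subset_ball (le_max_right _ _))⟩
  -- A cutoff in both variables makes the coefficients globally bounded in `C²`.
  let ψ : ContDiffBump (0 : ℂ × E) := ⟨r, r + 1, by linarith, by linarith⟩
  have hψ1 : ∀ ζ ∈ Metric.ball (0 : ℂ) r, ∀ v : E, ‖v‖ ≤ 1 → ψ (ζ, v) = 1 := fun ζ hζ v hv => by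
    refine ψ.one_of_mem_closedBall ?_
    rw [mem_closedBall_zero_iff, Prod.norm_mk]
    exact max_le (mem_ball_zero_iff.1 hζ).le (hv.trans hr1)
  obtain ⟨C₁, hC₁, a1, a2⟩ := exists_fderiv_bounds_of_hasCompactSupport
    (f := fun x => ψ x • A₀ x) (ψ.contDiff.smul hA₀c) ψ.hasCompactSupport.smul_right
  obtain ⟨C₂, hC₂, r1, r2⟩ := exists_fderiv_bounds_of_hasCompactSupport
    (f := fun x => ψ x • R₀ x) (ψ.contDiff.smul hR₀c) ψ.hasCompactSupport.smul_right
  obtain ⟨δ, w, hδ, hw, hsol, hwκ, hDw⟩ := exists_small_solution hΓ hΓne hΓ0 hα hα1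
    (A := fun x => ψ x • A₀ x) (R := fun x => ψ x • R₀ x) (C₀ := max C₁ C₂)
    (hC₁.trans (le_max_left _ _))
    ((ψ.contDiff.smul hA₀c).differentiable two_ne_zero)
    (fun x => (a1 x).trans (le_max_left _ _))
    (fun x y => (a2 x y).trans (by gcongr; exact le_max_left _ _))
    ((ψ.contDiff.smul hR₀c).differentiable two_ne_zero)
    (fun x => (r1 x).trans (le_max_right _ _))
    (fun x y => (r2 x y).trans (by gcongr; exact le_max_right _ _))
    (fun ζ => by
      have : (M (ζ, 0)).comp (PP ζ) = ContinuousLinearMap.id ℝ E := by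
        ext v; simp [hM, hPP, hQP]
      simp only [hA₀, this, sub_self, map_zero, smul_zero])
    (fun ζ hζ => by
      have : M (ζ, 0) = Q (u₀ ζ) := by simp [hM]
      simp only [hR₀, this, map_zero, add_zero, h0 ζ hζ, neg_zero, smul_zero]) hκ
  refine ⟨{ζ | Metric.infDist ζ Γ < δ} ∩ Metric.ball 0 r, w,
    (isOpen_lt (Metric.continuous_infDist_pt _) continuous_const).inter Metric.isOpen_ball,
    fun ζ hζ => ⟨by simpa [Metric.infDist_zero_of_mem hζ] using hδ, hr hζ⟩, hw, ?_, hwκ, hDw⟩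
  rintro ζ ⟨hζδ, hζr⟩
  have e1 := hsol ζ (le_of_lt hζδ)
  simp only [hψ1 ζ hζr (w ζ) ((hwκ ζ).trans hκ1), one_smul] at e1
  have hD : fderiv ℝ (fun ζ => u₀ ζ + P (u₀ ζ) (w ζ)) ζ =
      fderiv ℝ u₀ ζ + ((PP ζ).comp (fderiv ℝ w ζ) + (fderiv ℝ PP ζ).flip (w ζ)) :=
    ((hu₀.differentiable (by norm_num) ζ).hasFDerivAt.add
      ((hPPc.differentiable (by norm_num) ζ).hasFDerivAt.clm_apply
        (hw.differentiable one_ne_zero ζ).hasFDerivAt)).fderiv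
  rw [hD]
  rw [← dbar_apply] at e1
  simp only [hA₀, hR₀, ContinuousLinearMap.comp_add, map_sub, map_add] at e1
  change dbar E ((M (ζ, w ζ)).comp _) = 0
  simp only [ContinuousLinearMap.comp_add, map_add]
  have e2 : ∀ a b c d : E, a = a - b + -(c + d) → c + (b + d) = 0 := fun a b c d h => by
    have : a - (a - b + -(c + d)) = 0 := sub_eq_zero.2 h
    rw [← this]; abel
  exact e2 _ _ _ _ e1

end Correction

/-! ### Conjugation of the structure to the standard one -/

section Conjugation

variable {n : ℕ} {J : RealCn n → RealCn n →L[ℝ] RealCn n}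

theorem IsAdmissibleStructure.apply_apply (hJ : IsAdmissibleStructure J) (z v : RealCn n) :
    J z (J z v) = -v := by
  simpa using DFunLike.congr_fun (hJ.sq_eq_neg_id z) v

theorem Jst_apply (v : RealCn n) : Jst n v = Complex.I • v := rfl

/-- The operator `J + J_st` satisfies `J (J + J_st) = (J + J_st) J_st`, so its inverse conjugates
`J` to `J_st`. -/
theorem IsAdmissibleStructure.exists_conjugation (hJ : IsAdmissibleStructure J) :
    ∃ P Q : RealCn n → RealCn n →L[ℝ] RealCn n, ContDiff ℝ 3 P ∧ ContDiff ℝ 3 Q ∧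
      (∀ z v, Q z (P z v) = v) ∧ (∀ z v, P z (Q z v) = v) ∧
      ∀ z v, Q z (J z v) = Complex.I • Q z v := by
  set P : RealCn n → RealCn n →L[ℝ] RealCn n := fun z => J z + Jst n with hP
  set e : RealCn n → RealCn n ≃L[ℝ] RealCn n := fun z =>
    (P z).toContinuousLinearEquivOfDetNeZero (hJ.det_ne_zero z) with he
  have heP : ∀ z, (e z : RealCn n →L[ℝ] RealCn n) = P z := fun z => by ext; rfl
  have hPc : ContDiff ℝ 3 P := (hJ.smooth.of_le (by norm_cast)).add contDiff_const
  have hQe : ∀ z, (P z).inverse = (e z).symm := fun z => by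
    rw [← heP, ContinuousLinearMap.inverse_equiv]
  have hPe : ∀ z v, P z v = e z v := fun z v => rfl
  refine ⟨P, fun z => (P z).inverse, hPc, contDiff_iff_contDiffAt.2 fun z => ?_, fun z v => ?_,
    fun z v => ?_, fun z v => ?_⟩
  · have h := contDiffAt_map_inverse (𝕜 := ℝ) (n := 3) (e z)
    rw [heP] at h
    exact h.comp z hPc.contDiffAt
  · simp [hQe, hPe]
  · simp [hQe, hPe]
  · simp only [hQe, ContinuousLinearEquiv.coe_coe]
    rw [ContinuousLinearEquiv.symm_apply_eq, ← hPe]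
    obtain ⟨v', rfl⟩ := (e z).surjective v
    rw [ContinuousLinearEquiv.symm_apply_apply, ← hPe]
    simp only [hP, add_apply, map_add, hJ.apply_apply, Jst_apply]
    rw [smul_smul, Complex.I_mul_I, neg_one_smul, add_comm]

/-- Under the conjugation, the Cauchy–Riemann equation for `J` becomes the vanishing of the
`∂̄`-derivative. -/
theorem dbar_comp_eq_zero_iff (hJ : IsAdmissibleStructure J)
    {P Q : RealCn n → RealCn n →L[ℝ] RealCn n} (hPQ : ∀ z v, P z (Q z v) = v)
    (hQJ : ∀ z v, Q z (J z v) = Complex.I • Q z v) (z : RealCn n) (Λ : ℂ →L[ℝ] RealCn n) :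
    dbar (RealCn n) ((Q z).comp Λ) = 0 ↔ ∀ v : ℂ, J z (Λ v) = Λ (Complex.I * v) := by
  have hinj : ∀ a b, Q z a = Q z b → a = b := fun a b h => by rw [← hPQ z a, h, hPQ]
  have h1 : dbar (RealCn n) ((Q z).comp Λ) = Q z (Λ 1 + J z (Λ Complex.I)) := by
    rw [dbar_apply, map_add, hQJ]; rfl
  constructor
  · intro h v
    have h2 : Λ 1 = -J z (Λ Complex.I) := by
      rw [← add_eq_zero_iff_eq_neg]
      exact hinj _ _ (by rw [← h1, h, map_zero])
    have h3 : J z (Λ 1) = Λ Complex.I := by rw [h2, map_neg, hJ.apply_apply, neg_neg]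
    have ev : v = v.re • (1 : ℂ) + v.im • Complex.I := by
      simp [Complex.re_add_im]
    have ev' : Complex.I * v = v.re • Complex.I - v.im • (1 : ℂ) := by
      apply Complex.ext <;> simp
    rw [ev', ev]
    simp only [map_add, map_sub, map_smul, Complex.add_re, Complex.add_im, h3]
    simp
    rw [h2]
    module
  · intro h
    rw [h1, h, Complex.I_mul_I, ← map_add, add_neg_cancel, map_zero, map_zero]

/-- In the coordinate `t + i s` that straightens the arc, the extension `p t + s J(p t) p' t` of a
curve `p` satisfies the Cauchy–Riemann equation at `s = 0`. -/
theorem exists_approximate_solution (hJ : IsAdmissibleStructure J) {γ : ℝ → ℂ} {Θ : ℂ → ℂ}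
    (hΘ : ContDiff ℝ 3 Θ) (hΘγ : ∀ t ∈ Icc (0 : ℝ) 1, Θ (γ t) = t ∧
      ∀ v, fderiv ℝ Θ (γ t) v = (derivWithin γ (Icc 0 1) t)⁻¹ * v)
    {p : ℝ → RealCn n} (hp : ContDiff ℝ 4 p) :
    ∃ u₀ : ℂ → RealCn n, ContDiff ℝ 3 u₀ ∧ (∀ t ∈ Icc (0 : ℝ) 1, u₀ (γ t) = p t) ∧
      ∀ t ∈ Icc (0 : ℝ) 1, ∀ v, J (u₀ (γ t)) (fderiv ℝ u₀ (γ t) v) =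
        fderiv ℝ u₀ (γ t) (Complex.I * v) := by
  have hp' : ContDiff ℝ 3 (deriv p) := hp.deriv'
  set V : ℝ → RealCn n := fun t => J (p t) (deriv p t) with hV
  have hVc : ContDiff ℝ 3 V :=
    ((hJ.smooth.of_le (by norm_cast)).comp (hp.of_le (by norm_num))).clm_apply hp'
  have hre : ContDiff ℝ 3 fun ζ => (Θ ζ).re := Complex.reCLM.contDiff.comp hΘ
  have him : ContDiff ℝ 3 fun ζ => (Θ ζ).im := Complex.imCLM.contDiff.comp hΘ
  refine ⟨fun ζ => p (Θ ζ).re + (Θ ζ).im • V (Θ ζ).re,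
    ((hp.of_le (by norm_num)).comp hre).add (him.smul (hVc.comp hre)),
    fun t ht => by simp [(hΘγ t ht).1], fun t ht => ?_⟩
  have e1 : Θ (γ t) = t := (hΘγ t ht).1
  have dΘ := (hΘ.differentiable (by norm_num) (γ t)).hasFDerivAt
  have dre : HasFDerivAt (fun ζ => (Θ ζ).re) _ (γ t) := Complex.reCLM.hasFDerivAt.comp (γ t) dΘ
  have dim : HasFDerivAt (fun ζ => (Θ ζ).im) _ (γ t) := Complex.imCLM.hasFDerivAt.comp (γ t) dΘ
  have dp := (hp.differentiable (by norm_num) (Θ (γ t)).re).hasDerivAt.hasFDerivAt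
    |>.comp (f := fun ζ => (Θ ζ).re) (γ t) dre
  have dV := (hVc.differentiable (by norm_num) (Θ (γ t)).re).hasDerivAt.hasFDerivAt
    |>.comp (f := fun ζ => (Θ ζ).re) (γ t) dre
  have d := (dp.add (dim.smul dV)).fderiv
  have hd : ∀ v, fderiv ℝ (fun ζ => p (Θ ζ).re + (Θ ζ).im • V (Θ ζ).re) (γ t) v =
      ((derivWithin γ (Icc 0 1) t)⁻¹ * v).re • deriv p t +
        ((derivWithin γ (Icc 0 1) t)⁻¹ * v).im • V t := by
    intro v
    refine (DFunLike.congr_fun d v).trans ?_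
    simp [(hΘγ t ht).2, e1]
  intro v
  rw [hd, hd]
  simp only [e1, Complex.ofReal_re, Complex.ofReal_im, zero_smul, add_zero, map_add, map_smul, hV,
    hJ.apply_apply]
  rw [mul_left_comm, Complex.I_mul_re, Complex.I_mul_im]
  module

end Conjugation

/-! ### Size of the deviation along the arc -/

section Deviation

variable {E : Type*} [NormedAddCommGroup E] [NormedSpace ℝ E] {α : ℝ}

set_option maxSynthPendingDepth 3 in
/-- A curve that is `C²`-small on `[0, 1]` remains `C^{1,α}`-small on the arc when it is composed
with the parameter of the arc. -/
theorem exists_holderBound_comp_re (hα : 0 ≤ α) (hα1 : α ≤ 1) {γ : ℝ → ℂ} (hγ : IsSmoothArc γ)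
    {Θ : ℂ → ℂ} (hΘ : ContDiff ℝ 3 Θ) (hΘc : HasCompactSupport Θ)
    (hΘγ : ∀ t ∈ Icc (0 : ℝ) 1, Θ (γ t) = t) :
    ∃ C : ℝ, 0 < C ∧ ∀ (η : ℝ) (q : ℝ → E), 0 ≤ η → ContDiff ℝ 2 q →
      (∀ t ∈ Icc (0 : ℝ) 1, ‖q t‖ ≤ η ∧ ‖deriv q t‖ ≤ η ∧ ‖deriv (deriv q) t‖ ≤ η) →
      (∀ ζ ∈ arc γ, ‖q (Θ ζ).re‖ ≤ C * η) ∧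
        HolderBound α 1 (arc γ) (C * η) (fderiv ℝ fun ζ => q (Θ ζ).re) := by
  obtain ⟨L, hL, hLΘ⟩ := exists_lipschitz_of_hasCompactSupport (hΘ.of_le (by norm_num)) hΘc
  have hre : ContDiff ℝ 3 fun ζ => (Θ ζ).re := Complex.reCLM.contDiff.comp hΘ
  obtain ⟨N, hN, hNΘ⟩ := exists_holderBound_of_contDiff hα hα1 (isCompact_arc hγ)
    (hre.fderiv_right (m := 1) (by norm_num))
  set B := ContinuousLinearMap.smulRightL ℝ ℂ E with hB
  refine ⟨1 + 2 * ‖B‖ * N * (2 * L), by positivity, fun η q hη hq hqη => ?_⟩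
  have hmem : ∀ ζ ∈ arc γ, (Θ ζ).re ∈ Icc (0 : ℝ) 1 := by
    rintro _ ⟨t, ht, rfl⟩
    rw [hΘγ t ht, Complex.ofReal_re]
    exact ht
  have hq' : ContDiff ℝ 1 (deriv q) := hq.deriv'
  have hk : 0 ≤ 2 * ‖B‖ * N * (2 * L) * η := by positivity
  constructor
  · intro ζ hζ
    linarith [(hqη _ (hmem ζ hζ)).1]
  have h1 : HolderBound α 1 (arc γ) (2 * (L * η)) fun ζ => deriv q (Θ ζ).re := by
    refine HolderBound.of_lipschitz hα hα1 one_pos (by positivity)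
      (fun ζ hζ => (hqη _ (hmem ζ hζ)).2.1.trans (le_mul_of_one_le_left hη hL))
      fun x hx y hy => ?_
    have h2 := (convex_Icc (0 : ℝ) 1).norm_image_sub_le_of_norm_deriv_le
      (fun z _ => hq'.differentiable one_ne_zero z) (fun z hz => (hqη z hz).2.2)
      (hmem y hy) (hmem x hx)
    calc _ ≤ η * ‖(Θ x).re - (Θ y).re‖ := h2
      _ ≤ η * (L * ‖x - y‖) := by
          gcongr
          refine le_trans ?_ (hLΘ x y)
          rw [← Complex.sub_re]
          exact Complex.abs_re_le_norm _
      _ = _ := by ring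
  refine ((hNΘ.bilin B h1).congr fun ζ _ => ?_).mono one_pos (by linarith)
  have d := (hq.differentiable two_ne_zero (Θ ζ).re).hasDerivAt.hasFDerivAt.comp
    (f := fun ζ => (Θ ζ).re) ζ (hre.differentiable (by norm_num) ζ).hasFDerivAt
  refine d.fderiv.trans ?_
  ext v
  simp [hB]

set_option maxSynthPendingDepth 3 in
/-- Multiplication by a `C²` family of operators preserves smallness in `C^{1,α}`. -/
theorem exists_holderBound_clm_apply (hα : 0 ≤ α) (hα1 : α ≤ 1) {Γ : Set ℂ} (hΓ : IsCompact Γ)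
    {T : ℂ → E →L[ℝ] E} (hT : ContDiff ℝ 2 T) :
    ∃ C : ℝ, 0 < C ∧ ∀ (κ : ℝ) (w : ℂ → E), 0 ≤ κ → ContDiff ℝ 1 w → (∀ ζ, ‖w ζ‖ ≤ κ) →
      HolderBound α 1 univ κ (fderiv ℝ w) →
      (∀ ζ ∈ Γ, ‖T ζ (w ζ)‖ ≤ C * κ) ∧
        HolderBound α 1 Γ (C * κ) (fderiv ℝ fun ζ => T ζ (w ζ)) := by
  obtain ⟨N, hN, hNT⟩ := exists_holderBound_of_contDiff hα hα1 hΓ (hT.of_le (by norm_num))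
  have hT' : ContDiff ℝ 1 fun ζ => (fderiv ℝ T ζ).flip :=
    (ContinuousLinearMap.flipₗᵢ ℝ ℂ E E).contDiff.comp (hT.fderiv_right (m := 1) (by norm_num))
  obtain ⟨N', hN', hNT'⟩ := exists_holderBound_of_contDiff hα hα1 hΓ hT'
  set B := ContinuousLinearMap.compL ℝ ℂ E E
  set I := ContinuousLinearMap.id ℝ (E →L[ℝ] ℂ →L[ℝ] E)
  refine ⟨N + 2 * ‖B‖ * N + 2 * ‖I‖ * N' * 2, by positivity,
    fun κ w hκ hw hwκ hDw => ?_⟩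
  have k1 : 0 ≤ 2 * ‖B‖ * N * κ := by positivity
  have k2 : 0 ≤ 2 * ‖I‖ * N' * 2 * κ := by positivity
  have k3 : 0 ≤ N * κ := by positivity
  constructor
  · intro ζ hζ
    have := (T ζ).le_of_opNorm_le_of_le (hNT.1 ζ hζ) (hwκ ζ)
    linarith
  have h1 : HolderBound α 1 Γ (2 * κ) w := by
    refine HolderBound.of_lipschitz hα hα1 one_pos hκ (fun ζ _ => hwκ ζ) fun x _ y _ => ?_
    rw [div_one]
    exact convex_univ.norm_image_sub_le_of_norm_fderiv_le (𝕜 := ℝ)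
      (fun z _ => hw.differentiable one_ne_zero z) hDw.1 (mem_univ y) (mem_univ x)
  refine (((hNT.bilin B (hDw.mono_set (subset_univ Γ))).add (hNT'.bilin I h1)).congr
    fun ζ _ => ?_).mono one_pos (by linarith)
  exact ((hT.differentiable two_ne_zero ζ).hasFDerivAt.clm_apply
    (hw.differentiable one_ne_zero ζ).hasFDerivAt).fderiv

end Deviation

theorem theorem5 (n : ℕ) (J : RealCn n → RealCn n →L[ℝ] RealCn n) (hJ : IsAdmissibleStructure J)
    (α : ℝ) (hα0 : 0 < α) (hα1 : α < 1) (ε : ℝ) (hε : 0 < ε)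
    (γ : ℝ → ℂ) (hγ : IsSmoothArc γ) (φ : ℂ → RealCn n) (hφ : IsCkOnArc 2 γ φ) :
    ∃ (U : Set ℂ) (u : ℂ → RealCn n), IsOpen U ∧ arc γ ⊆ U ∧ IsJHolomorphicOn J u U ∧
      c1HolderNorm α γ (fun ζ => u ζ - φ ζ) < ENNReal.ofReal ε := by
  obtain ⟨Θ, hΘ, hΘc, hvol, hΘγ⟩ := exists_straightening hγ
  obtain ⟨C, hC, hnorm⟩ := exists_c1HolderNorm_le hγ hα0.le hα1.le n
  obtain ⟨C₁, hC₁, hdev₁⟩ := exists_holderBound_comp_re (E := RealCn n) hα0.le hα1.le hγ hΘ hΘc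
    fun t ht => (hΘγ t ht).1
  -- The constants `C` and `C₁` depend on the arc and on `α` alone, so `p` may be chosen after
  -- them; `C₂` depends on `u₀`, hence on `p`, and only restricts the size `κ` of the correction.
  obtain ⟨F, hF, hFφ⟩ := exists_contDiff_extension 2 (φ ∘ γ) hφ
  have hη : 0 < ε / (4 * C * C₁) := by positivity
  obtain ⟨p, hp, hpF⟩ := exists_contDiff_four_near hF hη
  obtain ⟨u₀, hu₀, hu₀p, hu₀J⟩ := exists_approximate_solution hJ hΘ hΘγ hp
  obtain ⟨P, Q, hP, hQ, hQP, hPQ, hQJ⟩ := hJ.exists_conjugation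
  obtain ⟨C₂, hC₂, hdev₂⟩ := exists_holderBound_clm_apply hα0.le hα1.le (isCompact_arc hγ)
    (T := fun ζ => P (u₀ ζ)) ((hP.comp hu₀).of_le (by norm_num))
  set κ := min 1 (ε / (4 * C * C₂)) with hκe
  have hκ : 0 < κ := lt_min one_pos (by positivity)
  obtain ⟨U, w, hU, hΓU, hw, hsol, hwκ, hDw⟩ := exists_corrected_solution (isCompact_arc hγ)
    ((nonempty_Icc.2 zero_le_one).image γ) hvol hα0 hα1 hP hQ hQP hu₀
    (by
      rintro _ ⟨t, ht, rfl⟩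
      exact (dbar_comp_eq_zero_iff hJ hPQ hQJ _ _).2 (hu₀J t ht)) hκ (min_le_left _ _)
  have hPw : ContDiff ℝ 1 fun ζ => P (u₀ ζ) (w ζ) :=
    ((hP.comp hu₀).of_le (by norm_num)).clm_apply hw
  refine ⟨U, fun ζ => u₀ ζ + P (u₀ ζ) (w ζ), hU, hΓU,
    ⟨((hu₀.of_le (by norm_num)).add hPw).contDiffOn,
      fun ζ hζ => (dbar_comp_eq_zero_iff hJ hPQ hQJ _ _).1 (hsol ζ hζ)⟩, ?_⟩
  -- On the arc, `u - φ` is `p - F` in the parameter of the arc plus the correction `P(u₀) w`.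
  have hqC : ContDiff ℝ 2 (p - F) := (hp.of_le (by norm_num)).sub hF
  have hdp : Differentiable ℝ p := hp.differentiable (by norm_num)
  have hdF : Differentiable ℝ F := hF.differentiable two_ne_zero
  have hq1 : deriv (p - F) = deriv p - deriv F := funext fun t => deriv_sub (hdp t) (hdF t)
  have hq2 : ∀ t, deriv (deriv (p - F)) t = deriv (deriv p) t - deriv (deriv F) t := fun t => by
    rw [hq1]
    exact deriv_sub
      ((hp.deriv' (n := 3)).differentiable (by norm_num) t)
      ((hF.deriv' (n := 1)).differentiable one_ne_zero t)
  obtain ⟨s1, d1⟩ := hdev₁ _ (p - F) hη.le hqC fun t ht =>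
    ⟨(hpF t ht).1, by rw [hq1]; exact (hpF t ht).2.1, by rw [hq2]; exact (hpF t ht).2.2⟩
  obtain ⟨s2, d2⟩ := hdev₂ κ w hκ.le hw hwκ hDw
  have hre : ContDiff ℝ 1 fun ζ => (Θ ζ).re :=
    Complex.reCLM.contDiff.comp (hΘ.of_le (by norm_num))
  have hqΘ : ContDiff ℝ 1 fun ζ => (p - F) (Θ ζ).re := (hqC.of_le (by norm_num)).comp hre
  refine (hnorm (C₁ * (ε / (4 * C * C₁)) + C₂ * κ)
    (fun ζ => (p - F) (Θ ζ).re + P (u₀ ζ) (w ζ)) _ (by positivity) (hqΘ.add hPw)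
    (fun ζ hζ => (norm_add_le _ _).trans (add_le_add (s1 ζ hζ) (s2 ζ hζ)))
    ((d1.add d2).congr fun ζ _ => fderiv_add (hqΘ.differentiable one_ne_zero ζ)
      (hPw.differentiable one_ne_zero ζ)) fun t ht => ?_).trans_lt ?_
  · have := hFφ t ht
    simp only [Function.comp_apply] at this
    simp only [hu₀p t ht, (hΘγ t ht).1, Complex.ofReal_re, Pi.sub_apply, this]
    abel
  · rw [ENNReal.ofReal_lt_ofReal_iff hε]
    have e1 : C * (C₁ * (ε / (4 * C * C₁))) = ε / 4 := by field_simp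
    have e2 : C * (C₂ * (ε / (4 * C * C₂))) = ε / 4 := by field_simp
    have e3 : C * (C₂ * κ) ≤ C * (C₂ * (ε / (4 * C * C₂))) := by
      gcongr; exact min_le_right _ _
    linarith
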